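/- Let $\lambda$ denote Lebesgue measure on $[0,1]$. For a measurable function $\phi:[0,1]^3\to[0,1]$ put $$T(\phi)=\int_{[0,1]^3}\Big(\int_0^1\phi(x,y,z')\,dz'\Big)\Big(\int_0^1\phi(x,y',z)\,dy'\Big)\Big(\int_0^1\phi(x',y,z)\,dx'\Big)\,dx\,dy\,dz .$$ For $\alpha\in[0,1]$ let $m(\alpha)$ be the infimum of $T(\phi)$ over all measurable $\phi:[0,1]^3\to[0,1]$ with $\int_{[0,1]^3}\phi\,d\lambda^3=\alpha$, and let $m'$ be the largest convex function on $[0,1]$ such that $m'\le m$ pointwise. Theorem. Let $\alpha\in[0,1]$. For every $\varepsilon>0$ there is an $N$, depending only on $\alpha$ and $\varepsilon$, such that for every $n\ge N$ and every set $A\subseteq[n]^2=\{1,\dots,n\}^2$ with $|A|\ge\alpha n^2$ there is an integer $r\ne 0$ for which $A$ contains at least $(m'(\alpha)-\varepsilon)n^2$ corners of the form $\{(x,y),(x,y+r),(x+r,y)\}$ with $x,y\in\mathbb Z$. In other words, $A$ contains at least $(m'(\alpha)-o(1))n^2$ corners with the same nonzero difference $r$, where $o(1)\to0$ as $n\to\infty$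 for fixed $\alpha$, uniformly in $A$. -/

import Mathlib

open MeasureTheory Set

noncomputable section

namespace PopularCorners

/-- The functional `T(φ) = ∫_{[0,1]³} (∫ φ(x,y,z') dz') (∫ φ(x,y',z) dy') (∫ φ(x',y,z) dx')`,
where `[0,1]` carries Lebesgue measure. -/
def T (φ : unitInterval × unitInterval × unitInterval → ℝ) : ℝ :=
  ∫ p : unitInterval × unitInterval × unitInterval,
    (∫ z' : unitInterval, φ (p.1, p.2.1, z')) *
    (∫ y' : unitInterval, φ (p.1, y', p.2.2)) *
    (∫ x' : unitInterval, φ (x', p.2.1, p.2.2))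

/-- The measurable functions `φ : [0,1]³ → [0,1]` of mean `α`. -/
def Admissible (α : ℝ) : Set (unitInterval × unitInterval × unitInterval → ℝ) :=
  {φ | Measurable φ ∧ (∀ p, φ p ∈ Icc (0 : ℝ) 1) ∧ ∫ p, φ p = α}

/-- `m(α)` is the infimum of `T(φ)` over measurable `φ : [0,1]³ → [0,1]` of mean `α`
(the set of values is nonempty and bounded below by `0` for `0 ≤ α ≤ 1`). -/
def m (α : ℝ) : ℝ := sInf (T '' Admissible α)

/-- `m'` is the largest convex function on `[0,1]` with `m' ≤ m` pointwise, that is, the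
pointwise supremum of all convex functions on `[0,1]` that lie below `m`. -/
def m' (α : ℝ) : ℝ :=
  sSup {t : ℝ | ∃ g : ℝ → ℝ,
    ConvexOn ℝ (Icc 0 1) g ∧ (∀ β ∈ Icc (0 : ℝ) 1, g β ≤ m β) ∧ t = g α}

/-- The number of corners `{(x,y), (x,y+r), (x+r,y)}` of difference `r` contained in `A`; for
`r ≠ 0` such a corner is determined by its vertex `(x,y)`. -/
def cornerCount (A : Finset (ℤ × ℤ)) (r : ℤ) : ℕ :=
  (A.filter fun p => (p.1, p.2 + r) ∈ A ∧ (p.1 + r, p.2) ∈ A).card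

end PopularCorners

end

/-!
The proof averages the number of corners of difference `r` over a suitable probability weight `ν`
on the differences and bounds this average from below. All the work is done in the group
`G = ℤ/nℤ`: if `ν` is concentrated on differences that are short compared to `n`, then corners
modulo `n` are corners in `ℤ²` except near the boundary, and if the Fourier transform of `ν` has
`ℓ¹` norm `O(1)`, then `r = 0` has weight `O(1/n)` and can be discarded.

A corner of difference `r` is spanned by a vertical line `a`, a horizontal line `b` and a diagonal
line `c` with `c - a - b = r`, and its points are `(a, b)`, `(a, c - a)`, `(c - b, b)`. Expanding
`ν (c - a - b)` into characters shows (`IsKernel.abs_sum_le_of_cutLE`) that the `ν`-average is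
insensitive to changes of the indicator function `f` of the set which have small cut norm compared
to the `ℓ¹` norm of the Fourier transform of `ν`, for the three pairs out of the coordinates `x`,
`y`, `x + y`. By a strong regularity lemma (`strong_regularity`, an energy increment argument) one
may therefore replace `f` by a function `Φ` of the colours of `x`, `y` and `x + y`, for a colouring
of `G` with boundedly many colours.

Take `ν = μ * μ * μ`. The average then becomes a local one: `a = u + h`, `b = v + k`,
`c = u + v + l` with `u`, `v` uniform and `h`, `k`, `l` distributed according to `μ`. The kernel
`μ` is chosen (`exists_regular_kernel`) such that each colour class is the sum of a part that is
nearly constant on translates of the support of `μ`, a part small in `ℓ¹`, and a part whose Fourier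
coefficients are tiny compared to the complexity of `μ`; this is again an energy argument, along a
sequence of kernels supported in smaller and smaller Bohr sets. It makes the colours of the lines
`a`, `b`, `c` and of the third coordinates of the three points behave independently
(`abs_lineSum_sixProd_sub_le`): they follow the local densities of the colours near `u`, `v` and
`u + v`. So the local corner density is `T φ`, where `φ` is the step function with values `Φ` whose
steps have these local densities as lengths (`exists_kernel_corner_count`,
`exists_admissible_T_eq`). It is at least `m` of the local mean, hence at least `g` of the local
mean for each convex `g ≤ m`. The local means average to the density of the set, up to a small
error which is absorbed by modifying `Φ`, and Jensen's inequality finishes the argument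
(`convex_minorant_le_sum_sixSum`).
-/

namespace PopularCorners

/-! ### Fourier analysis on a finite abelian group -/

/-- The unnormalised Fourier coefficient `∑ₓ f(x) γ(x)`. -/
def ft {G : Type} [AddCommGroup G] [Fintype G] (f : G → ℂ) (γ : AddChar G ℂ) : ℂ :=
  ∑ x, f x * γ x

section Fourier

variable {G : Type} [AddCommGroup G] [Fintype G]

lemma addChar_conj (γ : AddChar G ℂ) (x : G) : (starRingEnd ℂ) (γ x) = γ (-x) := by
  rw [AddChar.map_neg_eq_conj]

lemma addChar_norm (γ : AddChar G ℂ) (x : G) : ‖γ x‖ = 1 := AddChar.norm_apply γ x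

/-- Fourier inversion. -/
lemma sum_ft_mul (f : G → ℂ) (x : G) :
    ∑ γ : AddChar G ℂ, ft f γ * γ (-x) = Fintype.card G * f x := by
  classical
  have : ∀ γ : AddChar G ℂ, ft f γ * γ (-x) = ∑ y, f y * γ (y - x) := by
    intro γ
    rw [ft, Finset.sum_mul]
    refine Finset.sum_congr rfl fun y _ => ?_
    rw [sub_eq_add_neg, AddChar.map_add_eq_mul, mul_assoc]
  simp_rw [this]
  rw [Finset.sum_comm]
  simp_rw [← Finset.mul_sum, AddChar.sum_apply_eq_ite, sub_eq_zero]
  simp [mul_comm]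

lemma sum_ft_mul_ft (f g : G → ℂ) :
    ∑ γ : AddChar G ℂ, ft f γ * (starRingEnd ℂ) (ft g γ)
      = Fintype.card G * ∑ x, f x * (starRingEnd ℂ) (g x) := by
  have : ∀ γ : AddChar G ℂ, ft f γ * (starRingEnd ℂ) (ft g γ)
      = ∑ x, ft f γ * γ (-x) * (starRingEnd ℂ) (g x) := by
    intro γ
    rw [ft, ft, map_sum, Finset.mul_sum]
    refine Finset.sum_congr rfl fun y _ => ?_
    rw [map_mul, addChar_conj]; ring
  simp_rw [this]
  rw [Finset.sum_comm, Finset.mul_sum]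
  refine Finset.sum_congr rfl fun y _ => ?_
  rw [← Finset.sum_mul, sum_ft_mul]; ring

/-- Parseval's identity. -/
lemma sum_norm_ft_sq (f : G → ℂ) :
    ∑ γ : AddChar G ℂ, ‖ft f γ‖ ^ 2 = Fintype.card G * ∑ x, ‖f x‖ ^ 2 := by
  have h := sum_ft_mul_ft f f
  simp_rw [Complex.mul_conj, Complex.normSq_eq_norm_sq] at h
  exact_mod_cast h

lemma sum_norm_ft_sq_le (f : G → ℂ) (hf : ∀ x, ‖f x‖ ≤ 1) :
    ∑ γ : AddChar G ℂ, ‖ft f γ‖ ^ 2 ≤ (Fintype.card G : ℝ) ^ 2 := by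
  rw [sum_norm_ft_sq, sq]
  gcongr
  calc ∑ x, ‖f x‖ ^ 2 ≤ ∑ _x : G, (1 : ℝ) :=
        Finset.sum_le_sum fun x _ => pow_le_one₀ (norm_nonneg _) (hf x)
    _ = _ := by simp

end Fourier

/-- The function `F` on `X × Y` has cut norm at most `η`. The sums are not normalised, and the test
functions are complex functions bounded by `1`, which makes room for characters. -/
def CutLE {X Y : Type} [Fintype X] [Fintype Y] (F : X → Y → ℝ) (η : ℝ) : Prop :=
  ∀ (p : X → ℂ) (q : Y → ℂ), (∀ x, ‖p x‖ ≤ 1) → (∀ y, ‖q y‖ ≤ 1) →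
    ‖∑ x, ∑ y, (F x y : ℂ) * p x * q y‖ ≤ η

section Uniform

variable {G : Type} [AddCommGroup G] [Fintype G]

/-- A function with small Fourier coefficients gives rise to a function of `a + b` of small cut
norm, by Parseval's identity and Cauchy–Schwarz. -/
lemma cutLE_add_of_norm_ft_le (g : G → ℝ) (η : ℝ)
    (hg : ∀ γ : AddChar G ℂ, ‖ft (fun x => (g x : ℂ)) γ‖ ≤ η) :
    CutLE (fun a b : G => g (a + b)) (η * Fintype.card G) := by
  intro p q hp hq
  have hN : (0 : ℝ) < Fintype.card G := by exact_mod_cast Fintype.card_pos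
  have key : (Fintype.card G : ℂ) * ∑ x, ∑ y, (g (x + y) : ℂ) * p x * q y
      = ∑ γ : AddChar G ℂ, ft (fun x => (g x : ℂ)) γ * ft p γ⁻¹ * ft q γ⁻¹ := by
    have h1 : ∀ γ : AddChar G ℂ, ft (fun x => (g x : ℂ)) γ * ft p γ⁻¹ * ft q γ⁻¹
        = ∑ x, ∑ y, (ft (fun x => (g x : ℂ)) γ * γ (-(x + y))) * p x * q y := by
      intro γ
      rw [mul_assoc, ft.eq_1 p, ft.eq_1 q, Finset.sum_mul_sum, Finset.mul_sum]
      refine Finset.sum_congr rfl fun x _ => ?_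
      rw [Finset.mul_sum]
      refine Finset.sum_congr rfl fun y _ => ?_
      rw [neg_add, AddChar.map_add_eq_mul, AddChar.inv_apply, AddChar.inv_apply]; ring
    rw [Finset.sum_congr rfl fun γ _ => h1 γ, Finset.mul_sum]
    refine Eq.trans ?_ Finset.sum_comm
    refine Finset.sum_congr rfl fun x _ => ?_
    rw [Finset.mul_sum]
    refine Eq.trans ?_ Finset.sum_comm
    refine Finset.sum_congr rfl fun y _ => ?_
    rw [← Finset.sum_mul, ← Finset.sum_mul, sum_ft_mul]; ring
  have hη : 0 ≤ η := le_trans (norm_nonneg _) (hg 0)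
  have hinv : ∀ f : G → ℂ, (∀ x, ‖f x‖ ≤ 1) →
      ∑ γ : AddChar G ℂ, ‖ft f γ⁻¹‖ ^ 2 ≤ (Fintype.card G : ℝ) ^ 2 := by
    intro f hf
    exact (Equiv.sum_comp (Equiv.inv (AddChar G ℂ)) (fun γ => ‖ft f γ‖ ^ 2)).trans_le
      (sum_norm_ft_sq_le f hf)
  have h2 : ‖(Fintype.card G : ℂ) * ∑ x, ∑ y, (g (x + y) : ℂ) * p x * q y‖
      ≤ η * (Fintype.card G : ℝ) ^ 2 := by
    rw [key]
    calc _ ≤ ∑ γ : AddChar G ℂ, ‖ft (fun x => (g x : ℂ)) γ * ft p γ⁻¹ * ft q γ⁻¹‖ :=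
          norm_sum_le _ _
      _ ≤ ∑ γ : AddChar G ℂ, η * (‖ft p γ⁻¹‖ ^ 2 / 2 + ‖ft q γ⁻¹‖ ^ 2 / 2) := by
          refine Finset.sum_le_sum fun γ _ => ?_
          rw [norm_mul, norm_mul, mul_assoc]
          refine mul_le_mul (hg γ) ?_ (by positivity) hη
          nlinarith [sq_nonneg (‖ft p γ⁻¹‖ - ‖ft q γ⁻¹‖)]
      _ = η * ((∑ γ : AddChar G ℂ, ‖ft p γ⁻¹‖ ^ 2) / 2
            + (∑ γ : AddChar G ℂ, ‖ft q γ⁻¹‖ ^ 2) / 2) := by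
          rw [← Finset.mul_sum, Finset.sum_add_distrib, Finset.sum_div, Finset.sum_div]
      _ ≤ _ := by
          refine mul_le_mul_of_nonneg_left ?_ hη
          linarith [hinv p hp, hinv q hq]
  rw [norm_mul, Complex.norm_natCast] at h2
  have : (Fintype.card G : ℝ) * ‖∑ x, ∑ y, (g (x + y) : ℂ) * p x * q y‖
      ≤ (Fintype.card G : ℝ) * (η * Fintype.card G) := by linarith
  exact le_of_mul_le_mul_left this hN

end Uniform

/-! ### Bohr kernels -/

/-- `μ` is a symmetric probability weight on `G` whose Fourier transform is the function `t`,
with values in `[0,1]`. -/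
structure IsKernel {G : Type} [AddCommGroup G] [Fintype G] (μ : G → ℝ) (t : AddChar G ℂ → ℝ) :
    Prop where
  nonneg : ∀ x, 0 ≤ μ x
  sum_eq_one : ∑ x, μ x = 1
  symm : ∀ x, μ (-x) = μ x
  ft_nonneg : ∀ γ, 0 ≤ t γ
  ft_le_one : ∀ γ, t γ ≤ 1
  ft_eq : ∀ γ, ft (fun x => (μ x : ℂ)) γ = t γ

/-- Total boundedness of the unit circle, as a finite colouring with monochromatic distances at
most `ρ`. -/
lemma exists_coloring_unit_circle (ρ : ℝ) (hρ : 0 < ρ) :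
    ∃ (L : ℕ) (q : ℂ → Fin L), ∀ z w : ℂ, ‖z‖ = 1 → ‖w‖ = 1 → q z = q w → ‖z - w‖ ≤ ρ := by
  classical
  have hc : IsCompact (Metric.sphere (0 : ℂ) 1) := isCompact_sphere 0 1
  obtain ⟨s, hs, hfin, hcov⟩ := hc.finite_cover_balls (e := ρ / 2) (by positivity)
  have hch : ∀ z : ℂ, ‖z‖ = 1 → ∃ c ∈ s, dist z c < ρ / 2 := by
    intro z hz
    have := hcov (show z ∈ Metric.sphere (0 : ℂ) 1 by simpa using hz)
    simpa using this
  have hne : ∃ c, c ∈ s := by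
    obtain ⟨c, hc, _⟩ := hch 1 (by simp)
    exact ⟨c, hc⟩
  obtain ⟨c0, hc0⟩ := hne
  have : Fintype s := hfin.fintype
  let c : ℂ → s := fun z => if h : ‖z‖ = 1 then ⟨(hch z h).choose, (hch z h).choose_spec.1⟩
    else ⟨c0, hc0⟩
  refine ⟨Fintype.card s, fun z => Fintype.equivFin s (c z), fun z w hz hw h => ?_⟩
  have h1 : c z = c w := (Fintype.equivFin s).injective h
  have h2 : (c z : ℂ) = c w := by rw [h1]
  have hz' : dist z (c z) < ρ / 2 := by
    simp only [c, hz, dif_pos]; exact (hch z hz).choose_spec.2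
  have hw' : dist w (c w) < ρ / 2 := by
    simp only [c, hw, dif_pos]; exact (hch w hw).choose_spec.2
  rw [← dist_eq_norm]
  calc dist z w ≤ dist z (c z) + dist (c z : ℂ) w := dist_triangle _ _ _
    _ = dist z (c z) + dist w (c w) := by rw [h2, dist_comm w]
    _ ≤ ρ := by linarith

/-- Fourier inversion for a kernel, whose symmetry removes the sign. -/
lemma IsKernel.sum_ft {G : Type} [AddCommGroup G] [Fintype G] {μ : G → ℝ}
    {t : AddChar G ℂ → ℝ} (h : IsKernel μ t) (x : G) :
    ∑ γ : AddChar G ℂ, (t γ : ℂ) * γ x = Fintype.card G * μ x := by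
  have := sum_ft_mul (fun x => (μ x : ℂ)) (-x)
  simp_rw [h.ft_eq, neg_neg, h.symm] at this
  exact this

/-- For a set `B` lying in one cell of the map `x ↦ (γ x)_γ`, the normalised autocorrelation of
`1_B` is a kernel supported in a Bohr set; its Fourier transform `|1_B^|² / |B|²` is nonnegative
with sum `|G| / |B|`. -/
lemma exists_kernel (ρ : ℝ) (hρ : 0 < ρ) : ∃ L : ℕ, 1 ≤ L ∧
    ∀ (G : Type) [AddCommGroup G] [Fintype G] (Γ : Finset (AddChar G ℂ)),
    ∃ (μ : G → ℝ) (t : AddChar G ℂ → ℝ), IsKernel μ t ∧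
      (∀ x, μ x ≠ 0 → ∀ γ ∈ Γ, ‖γ x - 1‖ ≤ ρ) ∧ ∑ γ, t γ ≤ (L : ℝ) ^ Γ.card := by
  classical
  obtain ⟨L, q, hq⟩ := exists_coloring_unit_circle ρ hρ
  have hL : 1 ≤ L := by
    have := (q 1).pos
    omega
  refine ⟨L, hL, fun G _ _ Γ => ?_⟩
  let Q : G → (Γ → Fin L) := fun x γ => q (γ.1 x)
  have hNpos : (0 : ℝ) < Fintype.card G := by exact_mod_cast Fintype.card_pos
  have hLpos : (0 : ℝ) < (L : ℝ) ^ Γ.card := by positivity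
  have : Nonempty (Γ → Fin L) := ⟨fun _ => q 1⟩
  obtain ⟨y, hy⟩ := Fintype.exists_le_card_fiber_of_nsmul_le_card (M := ℝ) Q
    (b := (Fintype.card G : ℝ) / (L : ℝ) ^ Γ.card) (by
      simp only [Fintype.card_pi, Fintype.card_fin, Finset.prod_const, Finset.card_univ,
        Fintype.card_coe, nsmul_eq_mul, Nat.cast_pow]
      rw [mul_div_cancel₀ _ hLpos.ne'])
  set B : Finset G := {x | Q x = y} with hB
  have hBpos : (0 : ℝ) < B.card := lt_of_lt_of_le (by positivity) hy
  let β : G → ℝ := fun x => if x ∈ B then 1 else 0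
  have hβ : ∑ x, β x = B.card := by simp [β]
  let μ : G → ℝ := fun x => (∑ b, β b * β (b + x)) / (B.card : ℝ) ^ 2
  let t : AddChar G ℂ → ℝ := fun γ => ‖ft (fun x => (β x : ℂ)) γ‖ ^ 2 / (B.card : ℝ) ^ 2
  have hβ0 : ∀ x, 0 ≤ β x := fun x => by simp only [β]; split_ifs <;> norm_num
  have hsum : ∑ x, ∑ b, β b * β (b + x) = (B.card : ℝ) ^ 2 := by
    rw [Finset.sum_comm]
    simp_rw [← Finset.mul_sum]
    have : ∀ b, ∑ x, β (b + x) = B.card := fun b => by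
      rw [← hβ]; exact Equiv.sum_comp (Equiv.addLeft b) β
    simp_rw [this]
    rw [← Finset.sum_mul, hβ, sq]
  have hft : ∀ γ, ft (fun x => (μ x : ℂ)) γ = t γ := by
    intro γ
    have : (‖ft (fun x => (β x : ℂ)) γ‖ ^ 2 : ℂ)
        = ∑ x, (∑ b, (β b : ℂ) * β (b + x)) * γ x := by
      rw [← Complex.conj_mul', ft, map_sum, Finset.sum_mul]
      simp_rw [Finset.sum_mul]
      rw [Finset.sum_comm (s := Finset.univ (α := G)) (t := Finset.univ (α := G))
        (f := fun x b => (β b : ℂ) * β (b + x) * γ x)]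
      refine Finset.sum_congr rfl fun b _ => ?_
      rw [Finset.mul_sum, ← Equiv.sum_comp (Equiv.addLeft b)]
      refine Finset.sum_congr rfl fun x _ => ?_
      simp only [Equiv.coe_addLeft, map_mul, Complex.conj_ofReal]
      have h1 : γ x = γ (-b) * γ (b + x) := by
        rw [← AddChar.map_add_eq_mul]; congr 1; abel
      rw [addChar_conj, h1]; ring
    simp only [μ, t, ft]
    push_cast
    rw [show (‖∑ x, (β x : ℂ) * γ x‖ : ℂ) = (‖ft (fun x => (β x : ℂ)) γ‖ : ℂ) from rfl, this,
      Finset.sum_div]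
    refine Finset.sum_congr rfl fun x _ => ?_
    ring
  have hnn : ∀ x, 0 ≤ μ x := fun x =>
    div_nonneg (Finset.sum_nonneg fun b _ => mul_nonneg (hβ0 _) (hβ0 _)) (by positivity)
  have hone : ∑ x, μ x = 1 := by
    simp only [μ]
    rw [← Finset.sum_div, hsum, div_self (by positivity)]
  refine ⟨μ, t, ⟨hnn, hone, ?_, fun γ => by simp only [t]; positivity, ?_, hft⟩, ?_, ?_⟩
  · intro x
    simp only [μ]
    congr 1
    rw [← Equiv.sum_comp (Equiv.addRight x)]
    refine Finset.sum_congr rfl fun b _ => ?_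
    simp [mul_comm]
  · intro γ
    have h1 : ‖(t γ : ℂ)‖ ≤ 1 := by
      rw [← hft, ft]
      refine (norm_sum_le _ _).trans ?_
      rw [← hone]
      refine Finset.sum_le_sum fun x _ => ?_
      rw [norm_mul, addChar_norm, mul_one, Complex.norm_real, Real.norm_of_nonneg (hnn x)]
    rw [Complex.norm_real] at h1
    exact (le_abs_self _).trans h1
  · intro x hx γ hγ
    have h0 : ∑ b, β b * β (b + x) ≠ 0 := by
      intro h
      exact hx (by simp only [μ, h, zero_div])
    obtain ⟨b, -, hb⟩ := Finset.exists_ne_zero_of_sum_ne_zero h0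
    have hb1 : b ∈ B := by
      by_contra h
      exact hb (by simp [β, h])
    have hb2 : b + x ∈ B := by
      by_contra h
      exact hb (by simp [β, h])
    simp only [hB, Finset.mem_filter, Finset.mem_univ, true_and] at hb1 hb2
    have h3 : q (γ (b + x)) = q (γ b) := congrFun (hb2.trans hb1.symm) ⟨γ, hγ⟩
    have h4 := hq _ _ (addChar_norm γ _) (addChar_norm γ _) h3
    have h5 : γ (b + x) - γ b = γ b * (γ x - 1) := by rw [AddChar.map_add_eq_mul]; ring
    rwa [h5, norm_mul, addChar_norm, one_mul] at h4
  · have h1 : ∑ γ, t γ = Fintype.card G / B.card := by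
      simp only [t]
      rw [← Finset.sum_div, sum_norm_ft_sq]
      have : ∑ x, ‖(β x : ℂ)‖ ^ 2 = B.card := by
        rw [← hβ]
        refine Finset.sum_congr rfl fun x _ => ?_
        simp only [β]; split_ifs <;> simp
      rw [this]; field_simp
    rw [h1, div_le_iff₀ hBpos]
    rw [div_le_iff₀ hLpos] at hy
    linarith

/-! ### Regularising finitely many functions by a kernel -/

/-- The average of `τ (x + h)` over `h` with weights `μ h`; for the symmetric kernels used here
this is the convolution of `τ` and `μ`. -/
def conv {G : Type} [AddCommGroup G] [Fintype G] (μ τ : G → ℝ) (x : G) : ℝ :=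
  ∑ h, μ h * τ (x + h)

section Conv

variable {G : Type} [AddCommGroup G] [Fintype G] {μ : G → ℝ} {t : AddChar G ℂ → ℝ}

lemma IsKernel.conv_mem (h : IsKernel μ t) {τ : G → ℝ} (hτ : ∀ x, τ x ∈ Icc (0 : ℝ) 1) (x : G) :
    conv μ τ x ∈ Icc (0 : ℝ) 1 := by
  refine ⟨Finset.sum_nonneg fun y _ => mul_nonneg (h.nonneg _) (hτ _).1, ?_⟩
  rw [← h.sum_eq_one]
  exact Finset.sum_le_sum fun y _ => mul_le_of_le_one_right (h.nonneg _) (hτ _).2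

lemma IsKernel.ft_conv (h : IsKernel μ t) (τ : G → ℝ) (γ : AddChar G ℂ) :
    ft (fun x => (conv μ τ x : ℂ)) γ = t γ * ft (fun x => (τ x : ℂ)) γ := by
  have h1 : ft (fun x => (conv μ τ x : ℂ)) γ
      = ∑ k, (μ k : ℂ) * γ (-k) * ft (fun x => (τ x : ℂ)) γ := by
    simp only [ft, conv]
    push_cast
    simp_rw [Finset.sum_mul]
    rw [Finset.sum_comm]
    refine Finset.sum_congr rfl fun k _ => ?_
    rw [← Equiv.sum_comp (Equiv.addRight k) (fun x => (τ x : ℂ) * γ x), Finset.mul_sum]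
    refine Finset.sum_congr rfl fun x _ => ?_
    rw [Equiv.coe_addRight, AddChar.map_add_eq_mul]
    have : γ (-k) * γ k = 1 := by rw [← AddChar.map_add_eq_mul]; simp
    linear_combination (-(μ k : ℂ) * τ (x + k) * γ x) * this
  rw [h1, ← Finset.sum_mul]
  congr 1
  rw [← h.ft_eq, ft, ← Equiv.sum_comp (Equiv.neg G)]
  refine Finset.sum_congr rfl fun x _ => ?_
  simp [h.symm]

lemma ft_sub (f g : G → ℝ) (γ : AddChar G ℂ) :
    ft (fun x => ((f x - g x : ℝ) : ℂ)) γ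
      = ft (fun x => (f x : ℂ)) γ - ft (fun x => (g x : ℂ)) γ := by
  simp only [ft, ← Finset.sum_sub_distrib]
  refine Finset.sum_congr rfl fun x _ => ?_
  push_cast; ring

lemma ft_translate (f : G → ℝ) (h : G) (γ : AddChar G ℂ) :
    ft (fun x => (f (x + h) : ℂ)) γ = γ (-h) * ft (fun x => (f x : ℂ)) γ := by
  simp only [ft]
  rw [← Equiv.sum_comp (Equiv.addRight h) (fun x => (f x : ℂ) * γ x), Finset.mul_sum]
  refine Finset.sum_congr rfl fun x _ => ?_
  rw [Equiv.coe_addRight, AddChar.map_add_eq_mul]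
  have : γ (-h) * γ h = 1 := by rw [← AddChar.map_add_eq_mul]; simp
  linear_combination (-(f (x + h) : ℂ) * γ x) * this

/-- By Parseval and Cauchy–Schwarz, the `ℓ²` norm of the Fourier transform controls the `ℓ¹`
norm. -/
lemma sum_abs_le_of_ft (g : G → ℝ) (δ : ℝ) (hδ : 0 ≤ δ)
    (hg : ∑ γ : AddChar G ℂ, ‖ft (fun x => (g x : ℂ)) γ‖ ^ 2 ≤ δ ^ 2 * (Fintype.card G : ℝ) ^ 2) :
    ∑ x, |g x| ≤ δ * Fintype.card G := by
  rw [sum_norm_ft_sq] at hg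
  have h1 : (∑ x, |g x|) ^ 2 ≤ Fintype.card G * ∑ x, |g x| ^ 2 := by
    have := sq_sum_le_card_mul_sum_sq (s := (Finset.univ : Finset G)) (f := fun x => |g x|)
    simpa using this
  have h2 : ∑ x, |g x| ^ 2 = ∑ x, ‖(g x : ℂ)‖ ^ 2 := by simp
  rw [h2] at h1
  refine abs_le_of_sq_le_sq' ?_ (by positivity) |>.2
  rw [mul_pow]; linarith

lemma IsKernel.one_sub_ft_le (h : IsKernel μ t) (γ : AddChar G ℂ) (ρ : ℝ)
    (hμ : ∀ x, μ x ≠ 0 → ‖γ x - 1‖ ≤ ρ) : 1 - t γ ≤ ρ := by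
  have h1 : ((1 - t γ : ℝ) : ℂ) = ∑ x, (μ x : ℂ) * (1 - γ x) := by
    have := h.ft_eq γ
    have h2 : ∑ x, (μ x : ℂ) = 1 := by exact_mod_cast h.sum_eq_one
    simp only [mul_sub, mul_one, Finset.sum_sub_distrib, h2]
    rw [ft] at this
    rw [this]; push_cast; ring
  calc 1 - t γ ≤ ‖((1 - t γ : ℝ) : ℂ)‖ := by rw [Complex.norm_real]; exact le_abs_self _
    _ ≤ ∑ x, ‖(μ x : ℂ) * (1 - γ x)‖ := by rw [h1]; exact norm_sum_le _ _
    _ ≤ ∑ x, μ x * ρ := by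
        refine Finset.sum_le_sum fun x _ => ?_
        rw [norm_mul, Complex.norm_real, Real.norm_of_nonneg (h.nonneg x), norm_sub_rev]
        by_cases hx : μ x = 0
        · simp [hx]
        · exact mul_le_mul_of_nonneg_left (hμ x hx) (h.nonneg x)
    _ = ρ := by rw [← Finset.sum_mul, h.sum_eq_one, one_mul]

end Conv

lemma card_filter_le_sum_div {α : Type} [Fintype α] (f : α → ℝ) (hf : ∀ a, 0 ≤ f a) (c : ℝ)
    (hc : 0 < c) [DecidablePred fun a => c ≤ f a] :
    ((Finset.univ.filter fun a => c ≤ f a).card : ℝ) ≤ (∑ a, f a) / c := by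
  rw [le_div_iff₀ hc, ← nsmul_eq_mul, ← Finset.sum_const]
  refine (Finset.sum_le_sum fun a ha => (Finset.mem_filter.mp ha).2).trans ?_
  exact Finset.sum_le_sum_of_subset_of_nonneg (Finset.filter_subset _ _) fun a _ _ => hf a

/-- A sequence of Bohr kernels for growing sets of characters. Each kernel is nearly constant on
the characters where the previous one is not negligible, and captures, up to an error that is
small in terms of the complexity `M j` of the previous kernel, the large spectrum of all the
functions `τ i`. -/
lemma exists_kernel_chain (K : ℕ) (δ : ℝ) (hδ : 0 < δ) : ∃ M : ℕ → ℝ, (∀ j, 1 ≤ M j) ∧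
    ∀ (G : Type) [AddCommGroup G] [Fintype G] (γ₁ : AddChar G ℂ) (ι : Type) [Fintype ι]
      (τ : ι → G → ℝ), Fintype.card ι ≤ K → (∀ i x, τ i x ∈ Icc (0 : ℝ) 1) →
    ∃ (Γ : ℕ → Finset (AddChar G ℂ)) (κ : ℕ → G → ℝ) (t : ℕ → AddChar G ℂ → ℝ), ∀ j,
      γ₁ ∈ Γ j ∧ Γ j ⊆ Γ (j + 1) ∧ IsKernel (κ j) (t j) ∧ ∑ γ, t j γ ≤ M j ∧
      (∀ x, κ j x ≠ 0 → ∀ γ ∈ Γ j, ‖γ x - 1‖ ≤ δ) ∧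
      (∀ γ, γ ∉ Γ (j + 1) → t j γ ≤ δ) ∧
      (∀ γ ∈ Γ (j + 1), 1 - t (j + 1) γ ≤ δ / M j) ∧
      ∀ i γ, γ ∉ Γ (j + 1) → ‖ft (fun x => (τ i x : ℂ)) γ‖ ≤ δ / M j * Fintype.card G := by
  classical
  have hk : ∀ ρ : ℝ, ∃ L : ℕ, 1 ≤ L ∧ (0 < ρ → ∀ (G : Type) [AddCommGroup G] [Fintype G]
      (Γ : Finset (AddChar G ℂ)), ∃ (μ : G → ℝ) (t : AddChar G ℂ → ℝ), IsKernel μ t ∧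
      (∀ x, μ x ≠ 0 → ∀ γ ∈ Γ, ‖γ x - 1‖ ≤ ρ) ∧ ∑ γ, t γ ≤ (L : ℝ) ^ Γ.card) := by
    intro ρ
    by_cases hρ : 0 < ρ
    · obtain ⟨L, h1, h2⟩ := exists_kernel ρ hρ
      exact ⟨L, h1, fun _ => h2⟩
    · exact ⟨1, le_rfl, fun h => absurd h hρ⟩
  choose L hL1 hL using hk
  -- the pair (tolerance, bound for the number of characters)
  let step : ℝ × ℕ → ℝ × ℕ := fun s =>
    (δ / (L s.1 : ℝ) ^ s.2,
      s.2 + ⌈(L s.1 : ℝ) ^ s.2 / δ⌉₊ + K * ⌈((L s.1 : ℝ) ^ s.2 / δ) ^ 2⌉₊)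
  let par : ℕ → ℝ × ℕ := fun j => step^[j] (δ, 1)
  let M : ℕ → ℝ := fun j => (L (par j).1 : ℝ) ^ (par j).2
  have hpar : ∀ j, par (j + 1) = step (par j) := fun j => Function.iterate_succ_apply' _ _ _
  have hM : ∀ j, 1 ≤ M j := fun j => one_le_pow₀ (by exact_mod_cast hL1 _)
  have hρ1 : ∀ j, (par (j + 1)).1 = δ / M j := fun j => by rw [hpar]
  have hρpos : ∀ j, 0 < (par j).1 := by
    intro j
    cases j with
    | zero => exact hδ
    | succ j => rw [hρ1]; exact div_pos hδ (lt_of_lt_of_le one_pos (hM j))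
  have hρle : ∀ j, (par j).1 ≤ δ := by
    intro j
    cases j with
    | zero => exact le_rfl
    | succ j => rw [hρ1]; exact div_le_self hδ.le (hM j)
  refine ⟨M, hM, fun G _ _ γ₁ ι _ τ hι hτ => ?_⟩
  have hN : (0 : ℝ) < Fintype.card G := by exact_mod_cast Fintype.card_pos
  have hk2 := fun (j : ℕ) (Γ : Finset (AddChar G ℂ)) => hL (par j).1 (hρpos j) G Γ
  choose μ t hμ1 hμ2 hμ3 using hk2
  let big : ℕ → Finset (AddChar G ℂ) := fun j =>
    Finset.univ.biUnion fun i : ι => Finset.univ.filter fun γ =>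
      (δ / M j) ^ 2 * (Fintype.card G : ℝ) ^ 2 ≤ ‖ft (fun x => (τ i x : ℂ)) γ‖ ^ 2
  let Γ : ℕ → Finset (AddChar G ℂ) := fun j => Nat.rec {γ₁}
    (fun j S => S ∪ (Finset.univ.filter fun γ => δ ≤ t j S γ) ∪ big j) j
  have hΓ : ∀ j, Γ (j + 1)
      = Γ j ∪ (Finset.univ.filter fun γ => δ ≤ t j (Γ j) γ) ∪ big j := fun j => rfl
  have hsub : ∀ j, Γ j ⊆ Γ (j + 1) := fun j => by
    rw [hΓ, Finset.union_assoc]; exact Finset.subset_union_left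
  have hcard : ∀ j, (Γ j).card ≤ (par j).2 := by
    intro j
    induction j with
    | zero => simp [Γ, par]
    | succ j ih =>
      have hMpos : 0 < M j := lt_of_lt_of_le one_pos (hM j)
      have ht : ∑ γ, t j (Γ j) γ ≤ M j :=
        (hμ3 j (Γ j)).trans (pow_le_pow_right₀ (by exact_mod_cast hL1 _) ih)
      have h1 : (Finset.univ.filter fun γ => δ ≤ t j (Γ j) γ).card ≤ ⌈M j / δ⌉₊ := by
        have := card_filter_le_sum_div (t j (Γ j)) (hμ1 j (Γ j)).ft_nonneg δ hδ
        exact_mod_cast (this.trans (div_le_div_of_nonneg_right ht hδ.le)).trans (Nat.le_ceil _)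
      have h2 : (big j).card ≤ K * ⌈(M j / δ) ^ 2⌉₊ := by
        refine (Finset.card_biUnion_le_card_mul _ _ ⌈(M j / δ) ^ 2⌉₊ fun i _ => ?_).trans
          (Nat.mul_le_mul_right _ (by simpa using hι))
        have h3 := card_filter_le_sum_div
          (fun γ : AddChar G ℂ => ‖ft (fun x => (τ i x : ℂ)) γ‖ ^ 2) (fun γ => by positivity)
          ((δ / M j) ^ 2 * (Fintype.card G : ℝ) ^ 2) (by positivity)
        have h4 := sum_norm_ft_sq_le (fun x => (τ i x : ℂ)) (fun x => by
          rw [Complex.norm_real, Real.norm_of_nonneg (hτ i x).1]; exact (hτ i x).2)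
        have h5 : (∑ γ : AddChar G ℂ, ‖ft (fun x => (τ i x : ℂ)) γ‖ ^ 2)
            / ((δ / M j) ^ 2 * (Fintype.card G : ℝ) ^ 2) ≤ (M j / δ) ^ 2 := by
          rw [div_le_iff₀ (by positivity)]
          refine h4.trans_eq ?_
          field_simp
        exact_mod_cast (h3.trans h5).trans (Nat.le_ceil _)
      rw [hΓ, hpar]
      refine (Finset.card_union_le _ _).trans (add_le_add ((Finset.card_union_le _ _).trans
        (add_le_add ih h1)) h2)
  have hmem : ∀ j, γ₁ ∈ Γ j := by
    intro j
    induction j with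
    | zero => simp [Γ]
    | succ j ih => exact hsub j ih
  refine ⟨Γ, fun j => μ j (Γ j), fun j => t j (Γ j), fun j => ⟨hmem j, hsub j, hμ1 j _,
    (hμ3 j (Γ j)).trans (pow_le_pow_right₀ (by exact_mod_cast hL1 _) (hcard j)),
    fun x hx γ hγ => (hμ2 j _ x hx γ hγ).trans (hρle j), ?_, ?_, ?_⟩⟩
  · intro γ hγ
    by_contra h
    refine hγ ?_
    rw [hΓ]
    simp [(not_le.mp h).le]
  · intro γ hγ
    rw [← hρ1]
    exact (hμ1 (j + 1) _).one_sub_ft_le γ _ fun x hx => hμ2 (j + 1) _ x hx γ hγ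
  · intro i γ hγ
    by_contra h
    refine hγ ?_
    rw [hΓ]
    refine Finset.mem_union_right _ (Finset.mem_biUnion.mpr ⟨i, Finset.mem_univ _, ?_⟩)
    refine Finset.mem_filter.mpr ⟨Finset.mem_univ _, ?_⟩
    rw [← mul_pow]
    have hMpos : 0 < M j := lt_of_lt_of_le one_pos (hM j)
    exact pow_le_pow_left₀ (by positivity) (not_le.mp h).le 2

/-- `τ` is regular for the kernel `μ` with Fourier transform `t`: it is the sum of a function `s`
which is nearly invariant under translations in the support of `μ`, a function `σ - s` which is
small in `ℓ¹`, and a function `τ - σ` whose Fourier coefficients are small compared to the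
complexity `∑ t` of `μ`. -/
def RegularFor {G : Type} [AddCommGroup G] [Fintype G] (μ : G → ℝ) (t : AddChar G ℂ → ℝ)
    (δ : ℝ) (τ : G → ℝ) : Prop :=
  ∃ σ s : G → ℝ, (∀ x, σ x ∈ Icc (0 : ℝ) 1) ∧ (∀ x, s x ∈ Icc (0 : ℝ) 1) ∧
    (∃ η : ℝ, (∑ γ, t γ) * η ≤ δ ∧
      ∀ γ, ‖ft (fun x => ((τ x - σ x : ℝ) : ℂ)) γ‖ ≤ η * Fintype.card G) ∧
    ∑ x, |σ x - s x| ≤ δ * Fintype.card G ∧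
    ∀ h, μ h ≠ 0 → ∑ x, |s (x + h) - s x| ≤ δ * Fintype.card G

/-- Regularity for finitely many functions. Along a chain of kernels `κ j`, there are three steps
between which the functions `τ i` gain little energy; the middle kernel is `μ`, and smoothing
with the kernels before and after it gives the functions `s` and `σ`. -/
theorem exists_regular_kernel (K : ℕ) (δ : ℝ) (hδ : 0 < δ) : ∃ M : ℝ, 1 ≤ M ∧
    ∀ (G : Type) [AddCommGroup G] [Fintype G] (γ₁ : AddChar G ℂ) (ι : Type) [Fintype ι]
      (τ : ι → G → ℝ), Fintype.card ι ≤ K → (∀ i x, τ i x ∈ Icc (0 : ℝ) 1) →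
    ∃ (μ : G → ℝ) (t : AddChar G ℂ → ℝ), IsKernel μ t ∧ ∑ γ, t γ ≤ M ∧ 1 - t γ₁ ≤ δ ∧
      ∀ i, RegularFor μ t δ (τ i) := by
  classical
  -- the choice of `d` makes `d² + d`, `4 d²` and `d` all fit below `δ²` or `δ`
  obtain ⟨d, hd0, hd1, hd2, hd3⟩ : ∃ d : ℝ, 0 < d ∧ d ^ 2 + d ≤ δ ^ 2 ∧ d ≤ 1 ∧ 2 * d ≤ δ := by
    refine ⟨min δ 1 ^ 2 / 2, by positivity, ?_, ?_, ?_⟩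
    all_goals
      have h1 : 0 < min δ 1 := by positivity
      have h2 : min δ 1 ≤ 1 := min_le_right _ _
      have h3 : min δ 1 ≤ δ := min_le_left _ _
    · have h4 : min δ 1 ^ 2 ≤ 1 := pow_le_one₀ h1.le h2
      have h5 : min δ 1 ^ 2 ≤ δ ^ 2 := pow_le_pow_left₀ h1.le h3 2
      nlinarith [sq_nonneg (min δ 1)]
    · nlinarith
    · nlinarith
  obtain ⟨M, hM, hchain⟩ := exists_kernel_chain K d hd0
  obtain ⟨J, hJ⟩ := exists_nat_gt ((K : ℝ) / d)
  have hJ0 : 0 < J := by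
    have : (0 : ℝ) < J := lt_of_le_of_lt (by positivity) hJ
    exact_mod_cast this
  have hMle : ∀ j ∈ Finset.range (3 * J), M j ≤ ∑ i ∈ Finset.range (3 * J), M i := fun j hj =>
    Finset.single_le_sum (f := M) (fun i _ => (zero_le_one.trans (hM i))) hj
  refine ⟨∑ j ∈ Finset.range (3 * J), M j,
    (hM 0).trans (hMle 0 (by simp; omega)), fun G _ _ γ₁ ι _ τ hι hτ => ?_⟩
  obtain ⟨Γ, κ, t, h⟩ := hchain G γ₁ ι τ hι hτ
  have hN : (0 : ℝ) < Fintype.card G := by exact_mod_cast Fintype.card_pos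
  have hmono : Monotone Γ := monotone_nat_of_le_succ fun j => (h j).2.1
  let a : ι → AddChar G ℂ → ℝ := fun i γ => ‖ft (fun x => (τ i x : ℂ)) γ‖ ^ 2
  have ha0 : ∀ i γ, 0 ≤ a i γ := fun i γ => by positivity
  have hasum : ∀ i, ∑ γ, a i γ ≤ (Fintype.card G : ℝ) ^ 2 := fun i =>
    sum_norm_ft_sq_le _ fun x => by
      rw [Complex.norm_real, Real.norm_of_nonneg (hτ i x).1]; exact (hτ i x).2
  let e : ℕ → ℝ := fun j => ∑ i, ∑ γ ∈ Γ (3 * j), a i γ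
  obtain ⟨j, hjJ, hj⟩ : ∃ j, j < J ∧ e (j + 1) - e j ≤ d * (Fintype.card G : ℝ) ^ 2 := by
    by_contra! hcon
    have h1 : ∑ j ∈ Finset.range J, (e (j + 1) - e j) = e J - e 0 := Finset.sum_range_sub e J
    have h2 : ∑ _j ∈ Finset.range J, d * (Fintype.card G : ℝ) ^ 2
        ≤ ∑ j ∈ Finset.range J, (e (j + 1) - e j) :=
      Finset.sum_le_sum fun j hj => (hcon j (Finset.mem_range.mp hj)).le
    rw [h1, Finset.sum_const, Finset.card_range, nsmul_eq_mul] at h2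
    have h3 : 0 ≤ e 0 := Finset.sum_nonneg fun i _ => Finset.sum_nonneg fun γ _ => ha0 i γ
    have h4 : e J ≤ K * (Fintype.card G : ℝ) ^ 2 := by
      calc e J ≤ ∑ _i : ι, (Fintype.card G : ℝ) ^ 2 := Finset.sum_le_sum fun i _ =>
            (Finset.sum_le_sum_of_subset_of_nonneg (Finset.subset_univ _)
              fun γ _ _ => ha0 i γ).trans (hasum i)
        _ = Fintype.card ι * (Fintype.card G : ℝ) ^ 2 := by simp
        _ ≤ _ := by gcongr
    have h5 : (K : ℝ) < J * d := by rwa [div_lt_iff₀ hd0] at hJ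
    nlinarith [mul_pos hN hN]
  obtain ⟨-, -, hk0, -, -, ht0, -, -⟩ := h (3 * j)
  obtain ⟨hγ1, -, hk1, hM1, hsupp1, -, h2t, h2s⟩ := h (3 * j + 1)
  obtain ⟨-, -, hk2, -, -, ht2, -, -⟩ := h (3 * j + 2)
  have hgood0 : ∀ γ ∈ Γ (3 * j), 1 - t (3 * j) γ ≤ d := by
    intro γ hγ
    obtain ⟨-, -, hk, -, hs, -⟩ := h (3 * j)
    exact hk.one_sub_ft_le γ d fun x hx => hs x hx γ hγ
  have hMpos : 0 < M (3 * j + 1) := lt_of_lt_of_le one_pos (hM _)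
  refine ⟨κ (3 * j + 1), t (3 * j + 1), hk1,
    hM1.trans (hMle _ (Finset.mem_range.mpr (by omega))), ?_, fun i => ?_⟩
  · have := hk1.one_sub_ft_le γ₁ d fun x hx => hsupp1 x hx γ₁ hγ1
    linarith
  refine ⟨conv (κ (3 * j + 2)) (τ i), conv (κ (3 * j)) (τ i), hk2.conv_mem (hτ i),
    hk0.conv_mem (hτ i), ⟨d / M (3 * j + 1), ?_, fun γ => ?_⟩, ?_, fun x hx => ?_⟩
  · have h0 : 0 ≤ d / M (3 * j + 1) := by positivity
    have h1 : M (3 * j + 1) * (d / M (3 * j + 1)) = d := by field_simp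
    have := mul_le_mul_of_nonneg_right hM1 h0
    linarith
  · rw [ft_sub, hk2.ft_conv, ← one_sub_mul, norm_mul]
    have hnorm : ‖(1 - t (3 * j + 2) γ : ℂ)‖ = 1 - t (3 * j + 2) γ := by
      have : (1 - t (3 * j + 2) γ : ℂ) = ((1 - t (3 * j + 2) γ : ℝ) : ℂ) := by push_cast; rfl
      rw [this, Complex.norm_real, Real.norm_of_nonneg (by linarith [hk2.ft_le_one γ])]
    rw [hnorm]
    by_cases hγ : γ ∈ Γ (3 * j + 2)
    · refine mul_le_mul (h2t γ hγ) ?_ (norm_nonneg _) (by positivity)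
      rw [ft]
      refine (norm_sum_le _ _).trans ?_
      calc _ ≤ ∑ _x : G, (1 : ℝ) := Finset.sum_le_sum fun x _ => by
            rw [norm_mul, addChar_norm, mul_one, Complex.norm_real,
              Real.norm_of_nonneg (hτ i x).1]
            exact (hτ i x).2
        _ = _ := by simp
    · refine (mul_le_of_le_one_left (norm_nonneg _) ?_).trans (h2s i γ hγ)
      linarith [hk2.ft_nonneg γ]
  · refine sum_abs_le_of_ft _ δ hδ.le ?_
    -- characters in `Γ (3j)` or outside `Γ (3j+3)` contribute little since both transforms are
    -- close to `1`, respectively to `0`, there; the remaining ones carry little energy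
    have hpt : ∀ γ, ‖ft (fun x => ((conv (κ (3 * j + 2)) (τ i) x
        - conv (κ (3 * j)) (τ i) x : ℝ) : ℂ)) γ‖ ^ 2
        ≤ d ^ 2 * a i γ + if γ ∈ Γ (3 * j + 3) \ Γ (3 * j) then a i γ else 0 := by
      intro γ
      rw [ft_sub, hk2.ft_conv, hk0.ft_conv, ← sub_mul, norm_mul, mul_pow]
      have hreal : (t (3 * j + 2) γ - t (3 * j) γ : ℂ)
          = ((t (3 * j + 2) γ - t (3 * j) γ : ℝ) : ℂ) := by push_cast; rfl
      rw [hreal, Complex.norm_real, Real.norm_eq_abs, sq_abs]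
      change (t (3 * j + 2) γ - t (3 * j) γ) ^ 2 * a i γ ≤ _
      have b1 := hk0.ft_nonneg γ
      have b2 := hk0.ft_le_one γ
      have b3 := hk2.ft_nonneg γ
      have b4 := hk2.ft_le_one γ
      have hcase : |t (3 * j + 2) γ - t (3 * j) γ| ≤ d →
          (t (3 * j + 2) γ - t (3 * j) γ) ^ 2 * a i γ
          ≤ d ^ 2 * a i γ + if γ ∈ Γ (3 * j + 3) \ Γ (3 * j) then a i γ else 0 := by
        intro hle
        have h1 : (t (3 * j + 2) γ - t (3 * j) γ) ^ 2 ≤ d ^ 2 := by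
          rw [← sq_abs]; exact pow_le_pow_left₀ (abs_nonneg _) hle 2
        have h2 : 0 ≤ (if γ ∈ Γ (3 * j + 3) \ Γ (3 * j) then a i γ else 0) := by
          split_ifs
          · exact ha0 i γ
          · exact le_rfl
        linarith [mul_le_mul_of_nonneg_right h1 (ha0 i γ)]
      by_cases hA : γ ∈ Γ (3 * j)
      · apply hcase
        have c1 := hgood0 γ hA
        have c2 := h2t γ (hmono (by omega : 3 * j ≤ 3 * j + 1 + 1) hA)
        have c3 : d / M (3 * j + 1) ≤ d := div_le_self hd0.le (hM _)
        rw [abs_le]; constructor <;> linarith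
      by_cases hB : γ ∈ Γ (3 * j + 3)
      · rw [if_pos (Finset.mem_sdiff.mpr ⟨hB, hA⟩)]
        have h1 : (t (3 * j + 2) γ - t (3 * j) γ) ^ 2 ≤ 1 := by
          rw [sq_le_one_iff_abs_le_one, abs_le]; constructor <;> linarith
        have := mul_le_mul_of_nonneg_right h1 (ha0 i γ)
        have := mul_nonneg (sq_nonneg d) (ha0 i γ)
        linarith
      · apply hcase
        have c1 := ht2 γ hB
        have c2 := ht0 γ fun hh => hB (hmono (by omega) hh)
        rw [abs_le]; constructor <;> linarith
    refine (Finset.sum_le_sum fun γ _ => hpt γ).trans ?_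
    rw [Finset.sum_add_distrib, ← Finset.mul_sum, ← Finset.sum_filter]
    have hen : ∑ γ ∈ Finset.univ.filter (fun γ => γ ∈ Γ (3 * j + 3) \ Γ (3 * j)), a i γ
        ≤ d * (Fintype.card G : ℝ) ^ 2 := by
      have hf : Finset.univ.filter (fun γ => γ ∈ Γ (3 * j + 3) \ Γ (3 * j))
          = Γ (3 * j + 3) \ Γ (3 * j) := by ext; simp
      have hss : Γ (3 * j) ⊆ Γ (3 * j + 3) := hmono (by omega)
      rw [hf]
      refine le_trans ?_ hj
      have he : e (j + 1) - e j = ∑ i, ∑ γ ∈ Γ (3 * j + 3) \ Γ (3 * j), a i γ := by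
        simp only [e, ← Finset.sum_sub_distrib]
        refine Finset.sum_congr rfl fun i _ => ?_
        rw [show 3 * (j + 1) = 3 * j + 3 by ring, ← Finset.sum_sdiff hss]; ring
      rw [he]
      exact Finset.single_le_sum (f := fun i => ∑ γ ∈ Γ (3 * j + 3) \ Γ (3 * j), a i γ)
        (fun i _ => Finset.sum_nonneg fun γ _ => ha0 i γ) (Finset.mem_univ i)
    have h1 := mul_le_mul_of_nonneg_left (hasum i) (sq_nonneg d)
    have h2 := mul_le_mul_of_nonneg_right hd1 (sq_nonneg (Fintype.card G : ℝ))
    linarith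
  · refine sum_abs_le_of_ft (fun y => conv (κ (3 * j)) (τ i) (y + x) - conv (κ (3 * j)) (τ i) y)
      δ hδ.le ?_
    have hpt : ∀ γ, ‖ft (fun y => ((conv (κ (3 * j)) (τ i) (y + x)
        - conv (κ (3 * j)) (τ i) y : ℝ) : ℂ)) γ‖ ^ 2 ≤ δ ^ 2 * a i γ := by
      intro γ
      rw [ft_sub (fun y => conv (κ (3 * j)) (τ i) (y + x)), ft_translate, hk0.ft_conv,
        ← sub_one_mul, norm_mul, norm_mul, mul_pow, mul_pow]
      have hn : ‖γ (-x) - 1‖ = ‖γ x - 1‖ := by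
        rw [← addChar_conj, ← Complex.norm_conj (γ x - 1)]; simp
      have b1 := hk0.ft_nonneg γ
      have b2 := hk0.ft_le_one γ
      rw [hn, Complex.norm_real, Real.norm_of_nonneg b1, ← mul_assoc, ← mul_pow]
      refine mul_le_mul_of_nonneg_right ?_ (ha0 i γ)
      refine pow_le_pow_left₀ (by positivity) ?_ 2
      by_cases hγ : γ ∈ Γ (3 * j + 1)
      · have c1 := hsupp1 x hx γ hγ
        nlinarith [norm_nonneg (γ x - 1)]
      · have c1 := ht0 γ hγ
        have c2 : ‖γ x - 1‖ ≤ 2 := (norm_sub_le _ _).trans (by rw [addChar_norm]; norm_num)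
        nlinarith [norm_nonneg (γ x - 1)]
    refine (Finset.sum_le_sum fun γ _ => hpt γ).trans ?_
    rw [← Finset.mul_sum]
    exact mul_le_mul_of_nonneg_left (hasum i) (sq_nonneg δ)

/-! ### A strong regularity lemma for functions on `G × G` -/

section CellAverage

variable {Ω κ κ' : Type} [Fintype Ω]

open Classical in
/-- The average of `f` over the cell of colour `j` of the colouring `D` (and `0` if this cell is
empty). -/
noncomputable def cellAvg (f : Ω → ℝ) (D : Ω → κ) (j : κ) : ℝ :=
  (∑ ω with D ω = j, f ω) / (Finset.univ.filter fun ω => D ω = j).card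

lemma cellAvg_mem (f : Ω → ℝ) (hf : ∀ ω, f ω ∈ Icc (0 : ℝ) 1) (D : Ω → κ) (j : κ) :
    cellAvg f D j ∈ Icc (0 : ℝ) 1 := by
  classical
  refine ⟨div_nonneg (Finset.sum_nonneg fun ω _ => (hf ω).1) (by positivity), ?_⟩
  refine div_le_one_of_le₀ ?_ (by positivity)
  refine (Finset.sum_le_sum fun ω _ => (hf ω).2).trans ?_
  simp

/-- Subtracting the cell averages leaves a function orthogonal to all functions of the colour. -/
lemma sum_sub_cellAvg_mul [Fintype κ] (f : Ω → ℝ) (D : Ω → κ) (ψ : κ → ℝ) :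
    ∑ ω, (f ω - cellAvg f D (D ω)) * ψ (D ω) = 0 := by
  classical
  rw [← Finset.sum_fiberwise Finset.univ D]
  refine Finset.sum_eq_zero fun j _ => ?_
  have h1 : ∑ ω with D ω = j, (f ω - cellAvg f D (D ω)) * ψ (D ω)
      = ∑ ω with D ω = j, (f ω - cellAvg f D j) * ψ j := by
    refine Finset.sum_congr rfl fun ω hω => ?_
    rw [(Finset.mem_filter.mp hω).2]
  rw [h1, ← Finset.sum_mul, Finset.sum_sub_distrib, Finset.sum_const, nsmul_eq_mul]
  rcases Finset.eq_empty_or_nonempty (Finset.univ.filter fun ω => D ω = j) with h | h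
  · simp [h]
  · have : ((Finset.univ.filter fun ω => D ω = j).card : ℝ) ≠ 0 := by
      exact_mod_cast h.card_pos.ne'
    rw [cellAvg, mul_div_cancel₀ _ this, sub_self, zero_mul]

lemma sum_cellAvg [Fintype κ] (f : Ω → ℝ) (D : Ω → κ) : ∑ ω, cellAvg f D (D ω) = ∑ ω, f ω := by
  have := sum_sub_cellAvg_mul f D fun _ => 1
  simp only [mul_one, Finset.sum_sub_distrib] at this
  linarith

/-- The energy of a colouring: the squared `ℓ²` norm of the projection of `f` to functions of the
colour. -/
noncomputable def energy (f : Ω → ℝ) (D : Ω → κ) : ℝ := ∑ ω, cellAvg f D (D ω) ^ 2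

lemma energy_le (f : Ω → ℝ) (hf : ∀ ω, f ω ∈ Icc (0 : ℝ) 1) (D : Ω → κ) :
    energy f D ≤ Fintype.card Ω := by
  calc energy f D ≤ ∑ _ω : Ω, (1 : ℝ) := Finset.sum_le_sum fun ω _ =>
        pow_le_one₀ (cellAvg_mem f hf D _).1 (cellAvg_mem f hf D _).2
    _ = _ := by simp

lemma energy_nonneg (f : Ω → ℝ) (D : Ω → κ) : 0 ≤ energy f D :=
  Finset.sum_nonneg fun _ _ => sq_nonneg _

/-- Pythagoras' theorem for nested colourings. -/
lemma sum_sq_cellAvg_sub [Fintype κ] [Fintype κ'] (f : Ω → ℝ) (D : Ω → κ) (D' : Ω → κ') (π : κ' → κ)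
    (h : ∀ ω, D ω = π (D' ω)) :
    ∑ ω, (cellAvg f D' (D' ω) - cellAvg f D (D ω)) ^ 2 = energy f D' - energy f D := by
  have h1 := sum_sub_cellAvg_mul f D (cellAvg f D)
  have h2 := sum_sub_cellAvg_mul f D' fun j => cellAvg f D (π j)
  simp_rw [← h] at h2
  simp only [energy]
  rw [← Finset.sum_sub_distrib]
  have h3 : ∑ ω, (cellAvg f D' (D' ω) - cellAvg f D (D ω)) ^ 2
      = ∑ ω, ((cellAvg f D' (D' ω) ^ 2 - cellAvg f D (D ω) ^ 2)
        + 2 * ((f ω - cellAvg f D' (D' ω)) * cellAvg f D (D ω))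
        - 2 * ((f ω - cellAvg f D (D ω)) * cellAvg f D (D ω))) := by
    refine Finset.sum_congr rfl fun ω _ => ?_
    ring
  rw [h3, Finset.sum_sub_distrib, Finset.sum_add_distrib, ← Finset.mul_sum, ← Finset.mul_sum, h1,
    h2]
  ring

/-- Correlation of `f` minus its cell averages with a function of a finer colouring forces the
energy of the finer colouring to be larger. -/
lemma energy_increment [Fintype κ] [Fintype κ'] (f : Ω → ℝ) (D : Ω → κ) (D' : Ω → κ') (π : κ' → κ)
    (h : ∀ ω, D ω = π (D' ω)) (ψ : κ' → ℝ) (hψ : ∀ j, |ψ j| ≤ 1) :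
    (∑ ω, (f ω - cellAvg f D (D ω)) * ψ (D' ω)) ^ 2
      ≤ Fintype.card Ω * (energy f D' - energy f D) := by
  have h1 := sum_sub_cellAvg_mul f D' ψ
  have h2 : ∑ ω, (f ω - cellAvg f D (D ω)) * ψ (D' ω)
      = ∑ ω, (cellAvg f D' (D' ω) - cellAvg f D (D ω)) * ψ (D' ω) := by
    rw [← sub_eq_zero, ← Finset.sum_sub_distrib, ← h1]
    refine Finset.sum_congr rfl fun ω _ => ?_
    ring
  rw [h2, ← sum_sq_cellAvg_sub f D D' π h, mul_comm]
  refine (Finset.sum_mul_sq_le_sq_mul_sq _ _ _).trans ?_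
  refine mul_le_mul_of_nonneg_left ?_ (Finset.sum_nonneg fun _ _ => sq_nonneg _)
  calc ∑ ω, ψ (D' ω) ^ 2 ≤ ∑ _ω : Ω, (1 : ℝ) := Finset.sum_le_sum fun ω _ => by
        rw [sq_le_one_iff_abs_le_one]; exact hψ _
    _ = _ := by simp

end CellAverage

section Cut

/-- Bounds for subset sums extend to sums with bounded complex weights: it suffices to consider the
subsets on which the real or the imaginary part has a fixed sign. -/
lemma norm_sum_mul_le_of_subsets {X : Type} [Fintype X] (c : X → ℂ) (η : ℝ)
    (hc : ∀ S : Finset X, ‖∑ x ∈ S, c x‖ ≤ η) (p : X → ℂ) (hp : ∀ x, ‖p x‖ ≤ 1) :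
    ‖∑ x, c x * p x‖ ≤ 4 * η := by
  classical
  have key : ∀ r : X → ℝ, (∀ S : Finset X, |∑ x ∈ S, r x| ≤ η) → ∑ x, |r x| ≤ 2 * η := by
    intro r hr
    have h1 : ∑ x, |r x| = (∑ x with 0 ≤ r x, r x) - ∑ x with ¬ 0 ≤ r x, r x := by
      rw [← Finset.sum_filter_add_sum_filter_not Finset.univ (fun x => 0 ≤ r x), sub_eq_add_neg,
        ← Finset.sum_neg_distrib]
      congr 1
      · exact Finset.sum_congr rfl fun x hx => abs_of_nonneg (Finset.mem_filter.mp hx).2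
      · exact Finset.sum_congr rfl fun x hx =>
          abs_of_nonpos (not_le.mp (Finset.mem_filter.mp hx).2).le
    have h2 := abs_le.mp (hr (Finset.univ.filter fun x => 0 ≤ r x))
    have h3 := abs_le.mp (hr (Finset.univ.filter fun x => ¬ 0 ≤ r x))
    linarith
  have hre := key (fun x => (c x).re) fun S => by
    rw [← Complex.re_sum]; exact (Complex.abs_re_le_norm _).trans (hc S)
  have him := key (fun x => (c x).im) fun S => by
    rw [← Complex.im_sum]; exact (Complex.abs_im_le_norm _).trans (hc S)
  calc ‖∑ x, c x * p x‖ ≤ ∑ x, ‖c x * p x‖ := norm_sum_le _ _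
    _ ≤ ∑ x, (|(c x).re| + |(c x).im|) := Finset.sum_le_sum fun x _ => by
        rw [norm_mul]
        exact (mul_le_of_le_one_right (norm_nonneg _) (hp x)).trans
          (Complex.norm_le_abs_re_add_abs_im _)
    _ ≤ 4 * η := by rw [Finset.sum_add_distrib]; linarith

lemma cutLE_of_subsets {X Y : Type} [Fintype X] [Fintype Y] (F : X → Y → ℝ) (η : ℝ)
    (hF : ∀ (S : Finset X) (R : Finset Y), |∑ x ∈ S, ∑ y ∈ R, F x y| ≤ η) :
    CutLE F (16 * η) := by
  intro p q hp hq
  have h1 : ∀ S : Finset X, ‖∑ x ∈ S, ∑ y, (F x y : ℂ) * q y‖ ≤ 4 * η := by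
    intro S
    rw [Finset.sum_comm]
    simp_rw [← Finset.sum_mul]
    refine norm_sum_mul_le_of_subsets _ η (fun R => ?_) q hq
    rw [Finset.sum_comm]
    have := hF S R
    rw [← Real.norm_eq_abs, ← Complex.norm_real] at this
    push_cast at this
    exact this
  have h2 := norm_sum_mul_le_of_subsets (fun x => ∑ y, (F x y : ℂ) * q y) (4 * η) h1 p hp
  have h3 : ∑ x, ∑ y, (F x y : ℂ) * p x * q y = ∑ x, (∑ y, (F x y : ℂ) * q y) * p x := by
    refine Finset.sum_congr rfl fun x _ => ?_
    rw [Finset.sum_mul]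
    refine Finset.sum_congr rfl fun y _ => ?_
    ring
  rw [h3]; linarith

variable {G : Type} [AddCommGroup G] [Fintype G]

/-- `F` has small cut norm with respect to each two of the three coordinates `x`, `y`, `x + y`. -/
def CutSmall (F : G × G → ℝ) (η : ℝ) : Prop :=
  CutLE (fun a b => F (a, b)) η ∧ CutLE (fun a c => F (a, c - a)) η ∧
    CutLE (fun b c => F (c - b, b)) η

/-- The colouring of `G × G` induced by a colouring of `G` through `x`, `y` and `x + y`. -/
def pairColor {κ : Type} (C : G → κ) (ω : G × G) : κ × κ × κ := (C ω.1, C ω.2, C (ω.1 + ω.2))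

/-- If the cut norm is large, then splitting the colours by the two sets which witness this
increases the energy. -/
lemma exists_refinement {κ : Type} [Fintype κ] (f : G × G → ℝ) (C : G → κ) (η : ℝ) (hη : 0 ≤ η)
    (h : ¬ CutSmall (fun ω => f ω - cellAvg f (pairColor C) (pairColor C ω))
      (16 * (η * (Fintype.card G : ℝ) ^ 2))) :
    ∃ C' : G → κ × Bool × Bool, (∀ x, C x = (C' x).1) ∧
      energy f (pairColor C) + η ^ 2 * (Fintype.card G : ℝ) ^ 2 ≤ energy f (pairColor C') := by
  classical
  set F : G × G → ℝ := fun ω => f ω - cellAvg f (pairColor C) (pairColor C ω) with hF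
  have hN : (0 : ℝ) < Fintype.card G := by exact_mod_cast Fintype.card_pos
  have main : ∀ (S R : Finset G)
      (ψ : (κ × Bool × Bool) × (κ × Bool × Bool) × (κ × Bool × Bool) → ℝ), (∀ j, |ψ j| ≤ 1) →
      η * (Fintype.card G : ℝ) ^ 2 < |∑ ω, F ω * ψ (pairColor
        (fun x => (C x, decide (x ∈ S), decide (x ∈ R))) ω)| →
      ∃ C' : G → κ × Bool × Bool, (∀ x, C x = (C' x).1) ∧
        energy f (pairColor C) + η ^ 2 * (Fintype.card G : ℝ) ^ 2
          ≤ energy f (pairColor C') := by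
    intro S R ψ hψ hlt
    refine ⟨fun x => (C x, decide (x ∈ S), decide (x ∈ R)), fun x => rfl, ?_⟩
    have h1 := energy_increment f (pairColor C)
      (pairColor fun x => (C x, decide (x ∈ S), decide (x ∈ R)))
      (fun j => (j.1.1, j.2.1.1, j.2.2.1)) (fun ω => rfl) ψ hψ
    have h2 : (η * (Fintype.card G : ℝ) ^ 2) ^ 2 ≤ (∑ ω, F ω * ψ (pairColor
        (fun x => (C x, decide (x ∈ S), decide (x ∈ R))) ω)) ^ 2 := by
      rw [← sq_abs (∑ ω, _)]
      exact pow_le_pow_left₀ (by positivity) hlt.le 2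
    rw [Fintype.card_prod] at h1
    push_cast at h1
    have h3 := h2.trans h1
    have h4 : (Fintype.card G : ℝ) ^ 2 * (η ^ 2 * (Fintype.card G : ℝ) ^ 2)
        ≤ (Fintype.card G : ℝ) ^ 2 * (energy f (pairColor fun x =>
          (C x, decide (x ∈ S), decide (x ∈ R))) - energy f (pairColor C)) := by
      linarith
    have := le_of_mul_le_mul_left h4 (by positivity)
    linarith
  rw [CutSmall, not_and_or, not_and_or] at h
  rcases h with h | h | h
  · have := mt (cutLE_of_subsets _ _) h
    push Not at this
    obtain ⟨S, R, hSR⟩ := this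
    refine main S R (fun j => if j.1.2.1 = true ∧ j.2.1.2.2 = true then 1 else 0)
      (fun j => by split_ifs <;> simp) (hSR.trans_eq ?_)
    congr 1
    rw [Fintype.sum_prod_type, ← Finset.sum_filter_add_sum_filter_not Finset.univ (· ∈ S),
      Finset.filter_mem_eq_inter, Finset.univ_inter]
    rw [Finset.sum_eq_zero (s := Finset.univ.filter (· ∉ S)), add_zero]
    · refine Finset.sum_congr rfl fun x hx => ?_
      simp [pairColor, hx]
    · intro x hx
      simp [pairColor, (Finset.mem_filter.mp hx).2]
  · have := mt (cutLE_of_subsets _ _) h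
    push Not at this
    obtain ⟨S, R, hSR⟩ := this
    refine main S R (fun j => if j.1.2.1 = true ∧ j.2.2.2.2 = true then 1 else 0)
      (fun j => by split_ifs <;> simp) (hSR.trans_eq ?_)
    congr 1
    rw [Fintype.sum_prod_type, ← Finset.sum_filter_add_sum_filter_not Finset.univ (· ∈ S),
      Finset.filter_mem_eq_inter, Finset.univ_inter]
    rw [Finset.sum_eq_zero (s := Finset.univ.filter (· ∉ S)), add_zero]
    · refine Finset.sum_congr rfl fun x hx => ?_
      rw [← Equiv.sum_comp (Equiv.subRight x)]
      simp [pairColor, hx]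
    · intro x hx
      simp [pairColor, (Finset.mem_filter.mp hx).2]
  · have := mt (cutLE_of_subsets _ _) h
    push Not at this
    obtain ⟨S, R, hSR⟩ := this
    refine main S R (fun j => if j.2.1.2.1 = true ∧ j.2.2.2.2 = true then 1 else 0)
      (fun j => by split_ifs <;> simp) (hSR.trans_eq ?_)
    congr 1
    rw [Fintype.sum_prod_type_right, ← Finset.sum_filter_add_sum_filter_not Finset.univ (· ∈ S),
      Finset.filter_mem_eq_inter, Finset.univ_inter]
    rw [Finset.sum_eq_zero (s := Finset.univ.filter (· ∉ S)), add_zero]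
    · refine Finset.sum_congr rfl fun x hx => ?_
      rw [← Equiv.sum_comp (Equiv.subRight x)]
      simp [pairColor, hx]
    · intro x hx
      simp [pairColor, (Finset.mem_filter.mp hx).2]

/-- A weak regularity lemma relative to a given colouring; `J` counts the refinement steps that
the energy still allows. -/
lemma exists_cutSmall_refinement (f : G × G → ℝ) (hf : ∀ ω, f ω ∈ Icc (0 : ℝ) 1) (η : ℝ)
    (hη : 0 < η) (J : ℕ) : ∀ (κ : Type) [Fintype κ] (C : G → κ),
    (1 - J * η ^ 2) * (Fintype.card G : ℝ) ^ 2 ≤ energy f (pairColor C) →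
    ∃ (κ' : Type) (_ : Fintype κ') (C' : G → κ') (π : κ' → κ), (∀ x, C x = π (C' x)) ∧
      Fintype.card κ' ≤ 4 ^ J * Fintype.card κ ∧
      CutSmall (fun ω => f ω - cellAvg f (pairColor C') (pairColor C' ω))
        (16 * (η * (Fintype.card G : ℝ) ^ 2)) := by
  induction J with
  | zero =>
    intro κ _ C hC
    by_cases h : CutSmall (fun ω => f ω - cellAvg f (pairColor C) (pairColor C ω))
      (16 * (η * (Fintype.card G : ℝ) ^ 2))
    · exact ⟨κ, inferInstance, C, id, fun _ => rfl, by simp, h⟩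
    · obtain ⟨C', -, h2⟩ := exists_refinement f C η hη.le h
      have h3 := energy_le f hf (pairColor C')
      rw [Fintype.card_prod] at h3
      push_cast at h3 hC
      have hN : (0 : ℝ) < Fintype.card G := by exact_mod_cast Fintype.card_pos
      nlinarith [mul_pos (pow_pos hη 2) (pow_pos hN 2)]
  | succ J ih =>
    intro κ _ C hC
    by_cases h : CutSmall (fun ω => f ω - cellAvg f (pairColor C) (pairColor C ω))
      (16 * (η * (Fintype.card G : ℝ) ^ 2))
    · exact ⟨κ, inferInstance, C, id, fun _ => rfl,
        Nat.le_mul_of_pos_left _ (by positivity), h⟩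
    · obtain ⟨C', h1, h2⟩ := exists_refinement f C η hη.le h
      push_cast at hC
      obtain ⟨κ', i, C'', π, h3, h4, h5⟩ := ih _ C' (by linarith)
      refine ⟨κ', i, C'', fun j => (π j).1, fun x => by rw [h1, h3], h4.trans_eq ?_, h5⟩
      simp only [Fintype.card_prod, Fintype.card_bool]
      ring

end Cut

/-- Auxiliary form of the strong regularity lemma, by induction on the number `i` of energy
increments of size `ε` that are still possible. -/
lemma strong_regularity_aux (ε : ℝ) (hε : 0 < ε) (F : ℕ → ℝ) (hF : ∀ K, 0 < F K)
    (i : ℕ) :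
    ∀ K : ℕ, ∃ Kmax : ℕ, ∀ (G : Type) [AddCommGroup G] [Fintype G] (f : G × G → ℝ),
    (∀ ω, f ω ∈ Icc (0 : ℝ) 1) → ∀ (κ : Type) [Fintype κ] (C : G → κ), Fintype.card κ ≤ K →
    (1 - i * ε) * (Fintype.card G : ℝ) ^ 2 ≤ energy f (pairColor C) →
    ∃ (K' : ℕ) (κ' : Type) (_ : Fintype κ') (C' : G → κ') (g : G × G → ℝ), K' ≤ Kmax ∧
      Fintype.card κ' ≤ K' ∧ (∀ ω, g ω ∈ Icc (0 : ℝ) 1) ∧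
      ∑ ω, (g ω - cellAvg f (pairColor C') (pairColor C' ω)) ^ 2
        ≤ ε * (Fintype.card G : ℝ) ^ 2 ∧
      CutSmall (fun ω => f ω - g ω) (F K' * (Fintype.card G : ℝ) ^ 2) := by
  have weak : ∀ K : ℕ, ∃ J : ℕ, ∀ (G : Type) [AddCommGroup G] [Fintype G] (f : G × G → ℝ),
      (∀ ω, f ω ∈ Icc (0 : ℝ) 1) → ∀ (κ : Type) [Fintype κ] (C : G → κ),
      ∃ (κ' : Type) (_ : Fintype κ') (C' : G → κ') (π : κ' → κ), (∀ x, C x = π (C' x)) ∧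
        Fintype.card κ' ≤ 4 ^ J * Fintype.card κ ∧
        CutSmall (fun ω => f ω - cellAvg f (pairColor C') (pairColor C' ω))
          (F K * (Fintype.card G : ℝ) ^ 2) := by
    intro K
    have hη : 0 < F K / 16 := by linarith [hF K]
    obtain ⟨J, hJ⟩ := exists_nat_gt (1 / (F K / 16) ^ 2)
    refine ⟨J, fun G _ _ f hf κ _ C => ?_⟩
    obtain ⟨κ', i, C', π, h1, h2, h3⟩ := exists_cutSmall_refinement f hf (F K / 16) hη J κ C (by
      refine le_trans ?_ (energy_nonneg _ _)
      rw [div_lt_iff₀ (by positivity)] at hJ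
      exact mul_nonpos_of_nonpos_of_nonneg (by linarith) (by positivity))
    refine ⟨κ', i, C', π, h1, h2, ?_⟩
    have : 16 * (F K / 16 * (Fintype.card G : ℝ) ^ 2) = F K * (Fintype.card G : ℝ) ^ 2 := by ring
    rwa [this] at h3
  choose J hJ using weak
  induction i with
  | zero =>
    intro K
    refine ⟨K, fun G _ _ f hf κ _ C hC hen => ?_⟩
    obtain ⟨κ', i, C', π, h1, h2, h3⟩ := hJ K G f hf κ C
    refine ⟨K, κ, inferInstance, C, fun ω => cellAvg f (pairColor C') (pairColor C' ω), le_rfl,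
      hC, fun ω => cellAvg_mem f hf _ _, ?_, h3⟩
    rw [sum_sq_cellAvg_sub f (pairColor C) (pairColor C') (fun j => (π j.1, π j.2.1, π j.2.2))
      (fun ω => by simp [pairColor, h1])]
    have h4 := energy_le f hf (pairColor C')
    rw [Fintype.card_prod] at h4
    push_cast at h4 hen
    nlinarith [mul_nonneg hε.le (sq_nonneg (Fintype.card G : ℝ))]
  | succ i ih =>
    intro K
    obtain ⟨Kmax, hKmax⟩ := ih (4 ^ J K * K)
    refine ⟨max K Kmax, fun G _ _ f hf κ _ C hC hen => ?_⟩
    obtain ⟨κ', inst, C', π, h1, h2, h3⟩ := hJ K G f hf κ C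
    have hdiff := sum_sq_cellAvg_sub f (pairColor C) (pairColor C')
      (fun j => (π j.1, π j.2.1, π j.2.2)) (fun ω => by simp [pairColor, h1])
    by_cases hen' : energy f (pairColor C') - energy f (pairColor C)
        ≤ ε * (Fintype.card G : ℝ) ^ 2
    · exact ⟨K, κ, inferInstance, C, fun ω => cellAvg f (pairColor C') (pairColor C' ω),
        le_max_left _ _, hC, fun ω => cellAvg_mem f hf _ _, hdiff.trans_le hen', h3⟩
    · push_cast at hen
      obtain ⟨K', κ'', i'', C'', g, h4, h5⟩ := hKmax G f hf κ' C'
        (h2.trans (Nat.mul_le_mul_left _ hC)) (by linarith)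
      exact ⟨K', κ'', i'', C'', g, h4.trans (le_max_right _ _), h5⟩

/-- Strong regularity: `f` is approximated by a function of the colours of `x`, `y` and `x + y`,
up to an error which is small in `ℓ²` and an error whose cut norm is as small as required in terms
of the number of colours. -/
theorem strong_regularity (ε : ℝ) (hε : 0 < ε) (F : ℕ → ℝ) (hF : ∀ K, 0 < F K) :
    ∃ Kmax : ℕ, ∀ (G : Type) [AddCommGroup G] [Fintype G] (f : G × G → ℝ),
    (∀ ω, f ω ∈ Icc (0 : ℝ) 1) →
    ∃ (K : ℕ) (κ : Type) (_ : Fintype κ) (C : G → κ) (g : G × G → ℝ), K ≤ Kmax ∧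
      Fintype.card κ ≤ K ∧ (∀ ω, g ω ∈ Icc (0 : ℝ) 1) ∧
      ∑ ω, (g ω - cellAvg f (pairColor C) (pairColor C ω)) ^ 2
        ≤ ε * (Fintype.card G : ℝ) ^ 2 ∧
      CutSmall (fun ω => f ω - g ω) (F K * (Fintype.card G : ℝ) ^ 2) := by
  obtain ⟨i, hi⟩ := exists_nat_gt (1 / ε)
  rw [div_lt_iff₀ hε] at hi
  obtain ⟨Kmax, h⟩ := strong_regularity_aux ε hε F hF i 1
  refine ⟨Kmax, fun G _ _ f hf => h G f hf Unit (fun _ => ()) (by simp) ?_⟩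
  exact (mul_nonpos_of_nonpos_of_nonneg (by linarith) (by positivity)).trans (energy_nonneg _ _)

/-! ### Counting with a kernel -/

section Kernel

variable {G : Type} [AddCommGroup G] [Fintype G]

lemma IsKernel.conv {μ ν : G → ℝ} {s t : AddChar G ℂ → ℝ} (hμ : IsKernel μ s)
    (hν : IsKernel ν t) : IsKernel (conv μ ν) (fun γ => s γ * t γ) where
  nonneg x := Finset.sum_nonneg fun y _ => mul_nonneg (hμ.nonneg _) (hν.nonneg _)
  sum_eq_one := by
    simp only [PopularCorners.conv]
    rw [Finset.sum_comm, ← hμ.sum_eq_one]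
    refine Finset.sum_congr rfl fun h _ => ?_
    rw [← Finset.mul_sum]
    have : ∑ x, ν (x + h) = 1 := by
      rw [← hν.sum_eq_one]; exact Equiv.sum_comp (Equiv.addRight h) ν
    rw [this, mul_one]
  symm x := by
    simp only [PopularCorners.conv]
    rw [← Equiv.sum_comp (Equiv.neg G)]
    refine Finset.sum_congr rfl fun h _ => ?_
    simp only [Equiv.neg_apply, hμ.symm]
    rw [← hν.symm, neg_add, neg_neg, neg_neg]
  ft_nonneg γ := mul_nonneg (hμ.ft_nonneg γ) (hν.ft_nonneg γ)
  ft_le_one γ := mul_le_one₀ (hμ.ft_le_one γ) (hν.ft_nonneg γ) (hν.ft_le_one γ)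
  ft_eq γ := by rw [hμ.ft_conv, hν.ft_eq]; push_cast; rfl

/-- Expanding the kernel into characters, a weighted triangle sum is small as soon as one of its
three factors has small cut norm. -/
lemma IsKernel.abs_sum_le_of_cutLE {ν : G → ℝ} {t : AddChar G ℂ → ℝ} (hν : IsKernel ν t)
    (α β ζ : G → G) (F g h : G → G → ℝ) (E : ℝ) (hF : CutLE F E) (hg : ∀ x z, |g x z| ≤ 1)
    (hh : ∀ y z, |h y z| ≤ 1) :
    |∑ x, ∑ y, ∑ z, ν (α x + β y + ζ z) * (F x y * g x z * h y z)| ≤ (∑ γ, t γ) * E := by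
  have hN : (0 : ℝ) < Fintype.card G := by exact_mod_cast Fintype.card_pos
  have key : ((Fintype.card G * ∑ x, ∑ y, ∑ z, ν (α x + β y + ζ z) * (F x y * g x z * h y z) : ℝ)
      : ℂ) = ∑ z, ∑ γ, (t γ * γ (ζ z)) *
        ∑ x, ∑ y, (F x y : ℂ) * (γ (α x) * g x z) * (γ (β y) * h y z) := by
    have h1 : ∀ z, ∑ γ, (t γ * γ (ζ z)) *
        ∑ x, ∑ y, (F x y : ℂ) * (γ (α x) * g x z) * (γ (β y) * h y z)
        = ∑ x, ∑ y, (Fintype.card G * ν (α x + β y + ζ z) : ℂ) * (F x y * g x z * h y z) := by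
      intro z
      simp_rw [Finset.mul_sum]
      rw [Finset.sum_comm]
      refine Finset.sum_congr rfl fun x _ => ?_
      rw [Finset.sum_comm]
      refine Finset.sum_congr rfl fun y _ => ?_
      rw [← hν.sum_ft, Finset.sum_mul]
      refine Finset.sum_congr rfl fun γ _ => ?_
      rw [AddChar.map_add_eq_mul, AddChar.map_add_eq_mul]; ring
    rw [Finset.sum_congr rfl fun z _ => h1 z]
    push_cast
    rw [Finset.mul_sum]
    refine Eq.trans ?_ Finset.sum_comm
    refine Finset.sum_congr rfl fun x _ => ?_
    rw [Finset.mul_sum]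
    refine Eq.trans ?_ Finset.sum_comm
    refine Finset.sum_congr rfl fun y _ => ?_
    rw [Finset.mul_sum]
    refine Finset.sum_congr rfl fun z _ => ?_
    ring
  have hle : |(Fintype.card G * ∑ x, ∑ y, ∑ z,
      ν (α x + β y + ζ z) * (F x y * g x z * h y z) : ℝ)|
      ≤ Fintype.card G * ((∑ γ, t γ) * E) := by
    rw [← Real.norm_eq_abs, ← Complex.norm_real, key]
    calc _ ≤ ∑ _z : G, ∑ γ, t γ * E := by
          refine norm_sum_le_of_le _ fun z _ => norm_sum_le_of_le _ fun γ _ => ?_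
          rw [norm_mul, norm_mul, addChar_norm, mul_one, Complex.norm_real,
            Real.norm_of_nonneg (hν.ft_nonneg γ)]
          refine mul_le_mul_of_nonneg_left (hF _ _ (fun x => ?_) fun y => ?_) (hν.ft_nonneg γ)
          · rw [norm_mul, addChar_norm, one_mul, Complex.norm_real]; exact hg x z
          · rw [norm_mul, addChar_norm, one_mul, Complex.norm_real]; exact hh y z
      _ = _ := by rw [Finset.sum_const, ← Finset.sum_mul]; simp
  rw [abs_mul, abs_of_pos hN] at hle
  exact le_of_mul_le_mul_left hle hN

end Kernel

/-! ### The form of six functions -/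

section SixForm

variable {G : Type} [AddCommGroup G] [Fintype G]

/-- The weighted sum over triples `(a, b, c)`, thought of as a vertical, a horizontal and a
diagonal line; they span a corner of difference `c - a - b`. -/
def lineSum (ν : G → ℝ) (Ψ : G → G → G → ℝ) : ℝ :=
  ∑ a, ∑ b, ∑ c, ν (c - a - b) * Ψ a b c

/-- The average, with weights `μ` for each of `h`, `k`, `l`, of a function of
`((u, v), (h, k, l))`, summed over `u` and `v`. -/
def localSum (μ : G → ℝ) (F : (G × G) × (G × G × G) → ℝ) : ℝ :=
  ∑ ω, μ ω.2.1 * μ ω.2.2.1 * μ ω.2.2.2 * F ω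

/-- With `a = u + h`, `b = v + k`, `c = u + v + l`, the difference is `c - a - b = l - h - k`, and
the threefold convolution of `μ` is its distribution. -/
lemma lineSum_eq_localSum (μ : G → ℝ) (Ψ : G → G → G → ℝ) :
    lineSum (conv μ (conv μ μ)) Ψ
      = localSum μ fun ω => Ψ (ω.1.1 + ω.2.1) (ω.1.2 + ω.2.2.1) (ω.1.1 + ω.1.2 + ω.2.2.2) := by
  have h1 : lineSum (conv μ (conv μ μ)) Ψ
      = ∑ h, ∑ k, ∑ a, ∑ b, ∑ c, μ h * μ k * μ (c - a - b + h + k) * Ψ a b c := by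
    simp only [lineSum, conv, Finset.mul_sum, Finset.sum_mul]
    have e1 : ∀ F : G → G → G → G → G → ℝ, ∑ a, ∑ b, ∑ c, ∑ h, ∑ k, F a b c h k
        = ∑ h, ∑ k, ∑ a, ∑ b, ∑ c, F a b c h k := by
      intro F
      simp only [← Fintype.sum_prod_type']
      refine Fintype.sum_equiv ⟨fun x => (x.2.2.2.1, x.2.2.2.2, x.1, x.2.1, x.2.2.1),
        fun x => (x.2.2.1, x.2.2.2.1, x.2.2.2.2, x.1, x.2.1), fun _ => rfl, fun _ => rfl⟩ _ _
        fun _ => rfl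
    rw [e1]
    refine Finset.sum_congr rfl fun h _ => Finset.sum_congr rfl fun k _ =>
      Finset.sum_congr rfl fun a _ => Finset.sum_congr rfl fun b _ =>
      Finset.sum_congr rfl fun c _ => ?_
    ring
  have h2 : localSum μ (fun ω =>
      Ψ (ω.1.1 + ω.2.1) (ω.1.2 + ω.2.2.1) (ω.1.1 + ω.1.2 + ω.2.2.2))
      = ∑ h, ∑ k, ∑ u, ∑ v, ∑ l, μ h * μ k * μ l * Ψ (u + h) (v + k) (u + v + l) := by
    simp only [localSum, ← Fintype.sum_prod_type']
    refine Fintype.sum_equiv ⟨fun x => (x.2.1, x.2.2.1, x.1.1, x.1.2, x.2.2.2),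
        fun x => ((x.2.2.1, x.2.2.2.1), (x.1, x.2.1, x.2.2.2.2)), fun _ => rfl, fun _ => rfl⟩ _ _
        fun _ => rfl
  rw [h1, h2]
  refine Finset.sum_congr rfl fun h _ => Finset.sum_congr rfl fun k _ => ?_
  rw [← Equiv.sum_comp (Equiv.addRight h)]
  refine Finset.sum_congr rfl fun u _ => ?_
  rw [← Equiv.sum_comp (Equiv.addRight k)]
  refine Finset.sum_congr rfl fun v _ => ?_
  rw [← Equiv.sum_comp (Equiv.addLeft (u + v))]
  refine Finset.sum_congr rfl fun l _ => ?_
  simp only [Equiv.coe_addRight, Equiv.coe_addLeft]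
  congr 3
  abel

/-- The six factors attached to the lines `a`, `b`, `c` and to the third coordinates of the three
points in which these lines meet. -/
def sixProd (P Q R P' Q' R' : G → ℝ) (a b c : G) : ℝ :=
  P a * Q b * R c * P' (c - b) * Q' (c - a) * R' (a + b)

lemma abs_le_one_of_mem {x : ℝ} (hx : x ∈ Icc (0 : ℝ) 1) : |x| ≤ 1 :=
  abs_le.mpr ⟨by linarith [hx.1], hx.2⟩

lemma mul_mem_unit {x y : ℝ} (hx : x ∈ Icc (0 : ℝ) 1) (hy : y ∈ Icc (0 : ℝ) 1) :
    x * y ∈ Icc (0 : ℝ) 1 :=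
  ⟨mul_nonneg hx.1 hy.1, mul_le_one₀ hx.2 hy.1 hy.2⟩

lemma CutLE.comp_neg_left {g : G → ℝ} {E : ℝ} (h : CutLE (fun a b : G => g (a + b)) E) :
    CutLE (fun a b : G => g (b - a)) E := by
  intro p q hp hq
  have := h (fun x => p (-x)) q (fun x => hp _) hq
  rw [← Equiv.sum_comp (Equiv.neg G)]
  refine (congrArg norm ?_).trans_le this
  refine Finset.sum_congr rfl fun x _ => Finset.sum_congr rfl fun y _ => ?_
  simp only [Equiv.neg_apply]
  rw [sub_neg_eq_add, add_comm y x]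

lemma lineSum_sub (ν : G → ℝ) (Ψ Ψ' : G → G → G → ℝ) :
    lineSum ν Ψ - lineSum ν Ψ' = lineSum ν fun a b c => Ψ a b c - Ψ' a b c := by
  simp only [lineSum, ← Finset.sum_sub_distrib, mul_sub]

lemma lineSum_eq_right (ν : G → ℝ) (Ψ : G → G → G → ℝ) :
    lineSum ν Ψ = ∑ b, ∑ c, ∑ a, ν (c - a - b) * Ψ a b c := by
  rw [lineSum, Finset.sum_comm]
  exact Finset.sum_congr rfl fun _ _ => Finset.sum_comm

lemma lineSum_eq_mid (ν : G → ℝ) (Ψ : G → G → G → ℝ) :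
    lineSum ν Ψ = ∑ a, ∑ c, ∑ b, ν (c - a - b) * Ψ a b c :=
  Finset.sum_congr rfl fun _ _ => Finset.sum_comm

variable {ν : G → ℝ} {t : AddChar G ℂ → ℝ}

/-- The three variants, one for each pair of lines, of the bound for weighted triangle sums. -/
lemma IsKernel.abs_lineSum_le_left (hν : IsKernel ν t) (F g h : G → G → ℝ) (E : ℝ)
    (hF : CutLE F E) (hg : ∀ x z, |g x z| ≤ 1) (hh : ∀ y z, |h y z| ≤ 1) :
    |lineSum ν fun a b c => F a b * g a c * h b c| ≤ (∑ γ, t γ) * E := by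
  have := hν.abs_sum_le_of_cutLE (fun x => -x) (fun y => -y) id F g h E hF hg hh
  refine (congrArg abs ?_).trans_le this
  refine Finset.sum_congr rfl fun a _ => Finset.sum_congr rfl fun b _ =>
    Finset.sum_congr rfl fun c _ => ?_
  rw [show -a + -b + id c = c - a - b by simp only [id]; abel]

lemma IsKernel.abs_lineSum_le_mid (hν : IsKernel ν t) (F g h : G → G → ℝ) (E : ℝ)
    (hF : CutLE F E) (hg : ∀ x z, |g x z| ≤ 1) (hh : ∀ y z, |h y z| ≤ 1) :
    |lineSum ν fun a b c => F a c * g a b * h c b| ≤ (∑ γ, t γ) * E := by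
  have := hν.abs_sum_le_of_cutLE (fun x => -x) id (fun y => -y) F g h E hF hg hh
  rw [lineSum_eq_mid]
  convert this using 11
  simp only [id]; abel

lemma IsKernel.abs_lineSum_le_right (hν : IsKernel ν t) (F g h : G → G → ℝ) (E : ℝ)
    (hF : CutLE F E) (hg : ∀ x z, |g x z| ≤ 1) (hh : ∀ y z, |h y z| ≤ 1) :
    |lineSum ν fun a b c => F b c * g b a * h c a| ≤ (∑ γ, t γ) * E := by
  have := hν.abs_sum_le_of_cutLE (fun x => -x) id (fun y => -y) F g h E hF hg hh
  rw [lineSum_eq_right]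
  convert this using 11
  simp only [id]; abel

/-- Fourier-uniform errors in the factors at third coordinates do not matter. -/
lemma IsKernel.abs_lineSum_sixProd_sub (hν : IsKernel ν t) (E : ℝ)
    {P Q R P₁ Q₁ R₁ P₂ Q₂ R₂ : G → ℝ}
    (hP : ∀ x, P x ∈ Icc (0 : ℝ) 1) (hQ : ∀ x, Q x ∈ Icc (0 : ℝ) 1)
    (hR : ∀ x, R x ∈ Icc (0 : ℝ) 1) (hP₁ : ∀ x, P₁ x ∈ Icc (0 : ℝ) 1)
    (hQ₁ : ∀ x, Q₁ x ∈ Icc (0 : ℝ) 1) (hQ₂ : ∀ x, Q₂ x ∈ Icc (0 : ℝ) 1)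
    (hR₂ : ∀ x, R₂ x ∈ Icc (0 : ℝ) 1)
    (cP : CutLE (fun a b => P₁ (a + b) - P₂ (a + b)) E)
    (cQ : CutLE (fun a b => Q₁ (a + b) - Q₂ (a + b)) E)
    (cR : CutLE (fun a b => R₁ (a + b) - R₂ (a + b)) E) :
    |lineSum ν (sixProd P Q R P₁ Q₁ R₁) - lineSum ν (sixProd P Q R P₂ Q₂ R₂)|
      ≤ 3 * ((∑ γ, t γ) * E) := by
  have e1 := hν.abs_lineSum_le_left (fun a b => R₁ (a + b) - R₂ (a + b))
    (fun a c => P a * R c * Q₁ (c - a)) (fun b c => Q b * P₁ (c - b)) E cR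
    (fun a c => abs_le_one_of_mem (mul_mem_unit (mul_mem_unit (hP _) (hR _)) (hQ₁ _)))
    (fun b c => abs_le_one_of_mem (mul_mem_unit (hQ _) (hP₁ _)))
  have e2 := hν.abs_lineSum_le_mid (fun a c => Q₁ (c - a) - Q₂ (c - a))
    (fun a b => P a * Q b * R₂ (a + b)) (fun c b => R c * P₁ (c - b)) E
    (cQ.comp_neg_left (g := fun x => Q₁ x - Q₂ x))
    (fun a c => abs_le_one_of_mem (mul_mem_unit (mul_mem_unit (hP _) (hQ _)) (hR₂ _)))
    (fun b c => abs_le_one_of_mem (mul_mem_unit (hR _) (hP₁ _)))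
  have e3 := hν.abs_lineSum_le_right (fun b c => P₁ (c - b) - P₂ (c - b))
    (fun b a => P a * Q b * R₂ (a + b)) (fun c a => R c * Q₂ (c - a)) E
    (cP.comp_neg_left (g := fun x => P₁ x - P₂ x))
    (fun a c => abs_le_one_of_mem (mul_mem_unit (mul_mem_unit (hP _) (hQ _)) (hR₂ _)))
    (fun b c => abs_le_one_of_mem (mul_mem_unit (hR _) (hQ₂ _)))
  have hs : lineSum ν (sixProd P Q R P₁ Q₁ R₁) - lineSum ν (sixProd P Q R P₂ Q₂ R₂)
      = (lineSum ν fun a b c => (R₁ (a + b) - R₂ (a + b)) * (P a * R c * Q₁ (c - a))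
          * (Q b * P₁ (c - b)))
        + (lineSum ν fun a b c => (Q₁ (c - a) - Q₂ (c - a)) * (P a * Q b * R₂ (a + b))
          * (R c * P₁ (c - b)))
        + (lineSum ν fun a b c => (P₁ (c - b) - P₂ (c - b)) * (P a * Q b * R₂ (a + b))
          * (R c * Q₂ (c - a))) := by
    rw [lineSum_sub]
    simp only [lineSum, ← Finset.sum_add_distrib, sixProd]
    refine Finset.sum_congr rfl fun a _ => Finset.sum_congr rfl fun b _ =>
      Finset.sum_congr rfl fun c _ => ?_
    ring
  rw [hs]
  refine (abs_add_le _ _).trans ((add_le_add_left (abs_add_le _ _) _).trans ?_)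
  linarith

variable {μ : G → ℝ}

/-- A regular function is close in `ℓ¹` to its smoothing by the kernel. -/
lemma sum_abs_sub_conv_le (hμ : IsKernel μ t) {δ : ℝ} (hδ : 0 ≤ δ) {τ σ s : G → ℝ}
    (hu : ∃ η : ℝ, (∑ γ, t γ) * η ≤ δ ∧
      ∀ γ, ‖ft (fun x => ((τ x - σ x : ℝ) : ℂ)) γ‖ ≤ η * Fintype.card G)
    (hσ : ∑ x, |σ x - s x| ≤ δ * Fintype.card G)
    (hs : ∀ h, μ h ≠ 0 → ∑ x, |s (x + h) - s x| ≤ δ * Fintype.card G) :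
    ∑ x, |s x - conv μ τ x| ≤ 3 * δ * Fintype.card G := by
  have hN : (0 : ℝ) < Fintype.card G := by exact_mod_cast Fintype.card_pos
  have weighted : ∀ A : G → G → ℝ, (∀ h, μ h ≠ 0 → ∑ x, A x h ≤ δ * Fintype.card G) →
      ∑ x, ∑ h, μ h * A x h ≤ δ * Fintype.card G := by
    intro A hA
    rw [Finset.sum_comm]
    calc ∑ h, ∑ x, μ h * A x h ≤ ∑ h, μ h * (δ * Fintype.card G) := by
          refine Finset.sum_le_sum fun h _ => ?_
          rw [← Finset.mul_sum]
          by_cases h0 : μ h = 0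
          · simp [h0]
          · exact mul_le_mul_of_nonneg_left (hA h h0) (hμ.nonneg h)
      _ = _ := by rw [← Finset.sum_mul, hμ.sum_eq_one, one_mul]
  have h1 := weighted (fun x h => |s (x + h) - s x|) hs
  have h2 := weighted (fun x h => |σ (x + h) - s (x + h)|) (fun h _ => by
    exact (Equiv.sum_comp (Equiv.addRight h) (fun x => |σ x - s x|)).trans_le hσ)
  have h3 : ∑ x, |conv μ (fun x => τ x - σ x) x| ≤ δ * Fintype.card G := by
    obtain ⟨η, hη1, hη2⟩ := hu
    refine sum_abs_le_of_ft _ δ hδ ?_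
    have hη0 : 0 ≤ η := by
      have := (norm_nonneg _).trans (hη2 0)
      by_contra hneg
      nlinarith [not_le.mp hneg]
    have ht1 : 1 ≤ ∑ γ, t γ := by
      have h0 : t 0 = 1 := by
        have := hμ.ft_eq 0
        simp only [ft, AddChar.zero_apply, mul_one] at this
        rw [← Complex.ofReal_sum, hμ.sum_eq_one] at this
        exact_mod_cast this.symm
      rw [← h0]
      exact Finset.single_le_sum (f := t) (fun γ _ => hμ.ft_nonneg γ) (Finset.mem_univ _)
    have hηδ : η ≤ δ := (le_mul_of_one_le_left hη0 ht1).trans hη1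
    calc ∑ γ, ‖ft (fun x => (conv μ (fun x => τ x - σ x) x : ℂ)) γ‖ ^ 2
        ≤ ∑ γ, t γ * (η * Fintype.card G) ^ 2 := by
          refine Finset.sum_le_sum fun γ _ => ?_
          rw [hμ.ft_conv, norm_mul, Complex.norm_real, Real.norm_of_nonneg (hμ.ft_nonneg γ),
            mul_pow]
          refine mul_le_mul ?_ (pow_le_pow_left₀ (norm_nonneg _) (hη2 γ) 2) (by positivity)
            (hμ.ft_nonneg γ)
          have := hμ.ft_nonneg γ
          have := hμ.ft_le_one γ
          nlinarith
      _ = ((∑ γ, t γ) * η) * η * (Fintype.card G : ℝ) ^ 2 := by rw [← Finset.sum_mul]; ring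
      _ ≤ δ ^ 2 * (Fintype.card G : ℝ) ^ 2 := by
          rw [sq δ]
          exact mul_le_mul_of_nonneg_right (mul_le_mul hη1 hηδ hη0 hδ) (by positivity)
  have hpt : ∀ x, |s x - conv μ τ x| ≤ ∑ h, μ h * |s (x + h) - s x|
      + ∑ h, μ h * |σ (x + h) - s (x + h)| + |conv μ (fun x => τ x - σ x) x| := by
    intro x
    have e1 : s x - conv μ τ x = -(∑ h, μ h * (s (x + h) - s x))
        - (∑ h, μ h * (σ (x + h) - s (x + h))) - conv μ (fun x => τ x - σ x) x := by
      simp only [conv, mul_sub, Finset.sum_sub_distrib]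
      rw [← Finset.sum_mul, hμ.sum_eq_one]; ring
    have e2 : ∀ A : G → ℝ, |∑ h, μ h * A h| ≤ ∑ h, μ h * |A h| := fun A =>
      (Finset.abs_sum_le_sum_abs _ _).trans_eq (Finset.sum_congr rfl fun h _ => by
        rw [abs_mul, abs_of_nonneg (hμ.nonneg h)])
    have e3 := e2 fun h => s (x + h) - s x
    have e4 := e2 fun h => σ (x + h) - s (x + h)
    rw [e1]
    refine (abs_sub _ _).trans (add_le_add ((abs_sub _ _).trans (add_le_add ?_ e4)) le_rfl)
    rw [abs_neg]; exact e3
  calc _ ≤ _ := Finset.sum_le_sum fun x _ => hpt x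
    _ ≤ _ := by
      rw [Finset.sum_add_distrib, Finset.sum_add_distrib]
      linarith

/-- After the Fourier-uniform part of `τ` is removed, `τ` may be replaced by its smoothing at the
unshifted point: `e₁` and `e₂` are the two displacements by elements of the support of `μ`. -/
lemma localSum_le_of_shift (hμ : IsKernel μ t) {δ : ℝ} (hδ : 0 ≤ δ) {τ σ s : G → ℝ}
    (hu : ∃ η : ℝ, (∑ γ, t γ) * η ≤ δ ∧
      ∀ γ, ‖ft (fun x => ((τ x - σ x : ℝ) : ℂ)) γ‖ ≤ η * Fintype.card G)
    (hσ : ∑ x, |σ x - s x| ≤ δ * Fintype.card G)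
    (hs : ∀ h, μ h ≠ 0 → ∑ x, |s (x + h) - s x| ≤ δ * Fintype.card G)
    (b : G → G → G) (e₁ e₂ : G × G × G → G)
    (hb : ∀ F : G → ℝ, ∑ u, ∑ v, F (b u v) = Fintype.card G * ∑ x, F x)
    (he : ∀ d : G × G × G, μ d.1 ≠ 0 → μ d.2.1 ≠ 0 → μ d.2.2 ≠ 0 →
      μ (e₁ d) ≠ 0 ∧ μ (e₂ d) ≠ 0) :
    localSum μ (fun ω => |σ (b ω.1.1 ω.1.2 + e₁ ω.2 + e₂ ω.2) - conv μ τ (b ω.1.1 ω.1.2)|)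
      ≤ 6 * δ * (Fintype.card G : ℝ) ^ 2 := by
  have hN : (0 : ℝ) < Fintype.card G := by exact_mod_cast Fintype.card_pos
  have h3 := sum_abs_sub_conv_le hμ hδ hu hσ hs
  have inner : ∀ d : G × G × G, μ d.1 ≠ 0 → μ d.2.1 ≠ 0 → μ d.2.2 ≠ 0 →
      ∑ x, |σ (x + e₁ d + e₂ d) - conv μ τ x| ≤ 6 * δ * Fintype.card G := by
    intro d h1 h2 h4
    obtain ⟨k1, k2⟩ := he d h1 h2 h4
    have a1 : ∑ x, |σ (x + e₁ d + e₂ d) - s (x + e₁ d + e₂ d)| ≤ δ * Fintype.card G := by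
      have := Equiv.sum_comp (Equiv.addRight (e₁ d + e₂ d)) (fun x => |σ x - s x|)
      simp only [Equiv.coe_addRight, ← add_assoc] at this
      rw [this]; exact hσ
    have a2 : ∑ x, |s (x + e₁ d + e₂ d) - s (x + e₁ d)| ≤ δ * Fintype.card G := by
      exact (Equiv.sum_comp (Equiv.addRight (e₁ d)) (fun x => |s (x + e₂ d) - s x|)).trans_le
        (hs _ k2)
    have a3 := hs _ k1
    have hpt : ∀ x, |σ (x + e₁ d + e₂ d) - conv μ τ x|
        ≤ |σ (x + e₁ d + e₂ d) - s (x + e₁ d + e₂ d)| + |s (x + e₁ d + e₂ d) - s (x + e₁ d)|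
          + |s (x + e₁ d) - s x| + |s x - conv μ τ x| := by
      intro x
      have := abs_sub_le (σ (x + e₁ d + e₂ d)) (s (x + e₁ d + e₂ d)) (conv μ τ x)
      have := abs_sub_le (s (x + e₁ d + e₂ d)) (s (x + e₁ d)) (conv μ τ x)
      have := abs_sub_le (s (x + e₁ d)) (s x) (conv μ τ x)
      linarith
    refine (Finset.sum_le_sum fun x _ => hpt x).trans ?_
    simp only [Finset.sum_add_distrib]
    linarith
  rw [localSum, Fintype.sum_prod_type, Finset.sum_comm]
  have hd : ∀ d : G × G × G, ∑ p : G × G, μ d.1 * μ d.2.1 * μ d.2.2 *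
      |σ (b p.1 p.2 + e₁ d + e₂ d) - conv μ τ (b p.1 p.2)|
      ≤ μ d.1 * μ d.2.1 * μ d.2.2 * (6 * δ * (Fintype.card G : ℝ) ^ 2) := by
    intro d
    rw [← Finset.mul_sum]
    by_cases h1 : μ d.1 = 0
    · simp [h1]
    by_cases h2 : μ d.2.1 = 0
    · simp [h2]
    by_cases h4 : μ d.2.2 = 0
    · simp [h4]
    refine mul_le_mul_of_nonneg_left ?_
      (mul_nonneg (mul_nonneg (hμ.nonneg _) (hμ.nonneg _)) (hμ.nonneg _))
    rw [Fintype.sum_prod_type, hb fun x => |σ (x + e₁ d + e₂ d) - conv μ τ x|]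
    have := mul_le_mul_of_nonneg_left (inner d h1 h2 h4) hN.le
    linarith
  refine (Finset.sum_le_sum fun d _ => hd d).trans_eq ?_
  rw [← Finset.sum_mul, Fintype.sum_prod_type]
  simp only [Fintype.sum_prod_type, ← Finset.mul_sum, hμ.sum_eq_one, mul_one,
    one_mul]

lemma abs_mul_three_sub_le {X A₁ A₂ A₃ B₁ B₂ B₃ : ℝ} (hX : X ∈ Icc (0 : ℝ) 1)
    (hA₁ : A₁ ∈ Icc (0 : ℝ) 1) (hA₂ : A₂ ∈ Icc (0 : ℝ) 1)
    (hB₂ : B₂ ∈ Icc (0 : ℝ) 1) (hB₃ : B₃ ∈ Icc (0 : ℝ) 1) :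
    |X * A₁ * A₂ * A₃ - X * B₁ * B₂ * B₃| ≤ |A₁ - B₁| + |A₂ - B₂| + |A₃ - B₃| := by
  have e : X * A₁ * A₂ * A₃ - X * B₁ * B₂ * B₃ = (X * B₂ * B₃) * (A₁ - B₁)
      + (X * A₁ * B₃) * (A₂ - B₂) + (X * A₁ * A₂) * (A₃ - B₃) := by ring
  have h : ∀ c d : ℝ, c ∈ Icc (0 : ℝ) 1 → |c * d| ≤ |d| := fun c d hc => by
    rw [abs_mul]; exact mul_le_of_le_one_left (abs_nonneg _) (abs_le_one_of_mem hc)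
  rw [e]
  refine (abs_add_le _ _).trans (add_le_add ((abs_add_le _ _).trans (add_le_add ?_ ?_)) ?_)
  · exact h _ _ (mul_mem_unit (mul_mem_unit hX hB₂) hB₃)
  · exact h _ _ (mul_mem_unit (mul_mem_unit hX hA₁) hB₃)
  · exact h _ _ (mul_mem_unit (mul_mem_unit hX hA₁) hA₂)

/-- For regular functions the six-fold form factorises locally. -/
theorem abs_lineSum_sixProd_sub_le (hμ : IsKernel μ t) {δ : ℝ} (hδ : 0 ≤ δ)
    {P Q R P' Q' R' : G → ℝ}
    (hP : ∀ x, P x ∈ Icc (0 : ℝ) 1) (hQ : ∀ x, Q x ∈ Icc (0 : ℝ) 1)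
    (hR : ∀ x, R x ∈ Icc (0 : ℝ) 1) (hP' : ∀ x, P' x ∈ Icc (0 : ℝ) 1)
    (hQ' : ∀ x, Q' x ∈ Icc (0 : ℝ) 1) (hR' : ∀ x, R' x ∈ Icc (0 : ℝ) 1)
    (rP : RegularFor μ t δ P') (rQ : RegularFor μ t δ Q') (rR : RegularFor μ t δ R') :
    |lineSum (conv μ (conv μ μ)) (sixProd P Q R P' Q' R')
      - ∑ u, ∑ v, conv μ P u * conv μ Q v * conv μ R (u + v)
        * conv μ P' u * conv μ Q' v * conv μ R' (u + v)|
      ≤ 21 * δ * (Fintype.card G : ℝ) ^ 2 := by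
  have hN : (0 : ℝ) < Fintype.card G := by exact_mod_cast Fintype.card_pos
  have hν := hμ.conv (hμ.conv hμ)
  obtain ⟨p, p₀, bp, -, up, lp, ip⟩ := rP
  obtain ⟨q, q₀, bq, -, uq, lq, iq⟩ := rQ
  obtain ⟨r, r₀, br, -, ur, lr, ir⟩ := rR
  have hcut : ∀ τ σ : G → ℝ, (∃ η : ℝ, (∑ γ, t γ) * η ≤ δ ∧
      ∀ γ, ‖ft (fun x => ((τ x - σ x : ℝ) : ℂ)) γ‖ ≤ η * Fintype.card G) →
      ∃ E, (∑ γ, t γ) * E ≤ δ * (Fintype.card G : ℝ) ^ 2 ∧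
        CutLE (fun a b => τ (a + b) - σ (a + b)) E := by
    rintro τ σ ⟨η, h1, h2⟩
    refine ⟨η * Fintype.card G * Fintype.card G, ?_,
      cutLE_add_of_norm_ft_le (fun x => τ x - σ x) _ h2⟩
    have := mul_le_mul_of_nonneg_right h1 (sq_nonneg (Fintype.card G : ℝ))
    linarith
  obtain ⟨E₁, hE₁, c₁⟩ := hcut _ _ up
  obtain ⟨E₂, hE₂, c₂⟩ := hcut _ _ uq
  obtain ⟨E₃, hE₃, c₃⟩ := hcut _ _ ur
  have step1 : |lineSum (conv μ (conv μ μ)) (sixProd P Q R P' Q' R')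
      - lineSum (conv μ (conv μ μ)) (sixProd P Q R p q r)| ≤ 3 * δ * (Fintype.card G : ℝ) ^ 2 := by
    have hmono : ∀ {E E' : ℝ} {F : G → G → ℝ}, CutLE F E → E ≤ E' → CutLE F E' :=
      fun h hE p q hp hq => (h p q hp hq).trans hE
    have h0 := hν.abs_lineSum_sixProd_sub (max E₁ (max E₂ E₃)) hP hQ hR hP' hQ' bq br
      (hmono c₁ (le_max_left _ _)) (hmono c₂ ((le_max_left _ _).trans (le_max_right _ _)))
      (hmono c₃ ((le_max_right _ _).trans (le_max_right _ _)))
    have hE0 : 0 ≤ max E₁ (max E₂ E₃) := by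
      have := c₁ 0 0 (by simp) (by simp)
      exact ((norm_nonneg _).trans this).trans (le_max_left _ _)
    have h1 : (∑ γ, t γ * (t γ * t γ)) ≤ ∑ γ, t γ := Finset.sum_le_sum fun γ _ =>
      mul_le_of_le_one_right (hμ.ft_nonneg γ)
        (mul_le_one₀ (hμ.ft_le_one γ) (hμ.ft_nonneg γ) (hμ.ft_le_one γ))
    have h2 : (∑ γ, t γ) * max E₁ (max E₂ E₃) ≤ δ * (Fintype.card G : ℝ) ^ 2 := by
      rcases max_choice E₁ (max E₂ E₃) with h | h
      · rw [h]; exact hE₁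
      · rw [h]
        rcases max_choice E₂ E₃ with h | h
        · rw [h]; exact hE₂
        · rw [h]; exact hE₃
    have h3 := mul_le_mul_of_nonneg_right h1 hE0
    linarith
  -- the smoothed product, written as a local sum
  have hprod : ∑ u, ∑ v, conv μ P u * conv μ Q v * conv μ R (u + v)
        * conv μ P' u * conv μ Q' v * conv μ R' (u + v)
      = localSum μ fun ω => (P (ω.1.1 + ω.2.1) * Q (ω.1.2 + ω.2.2.1)
        * R (ω.1.1 + ω.1.2 + ω.2.2.2)) * conv μ P' ω.1.1 * conv μ Q' ω.1.2
        * conv μ R' (ω.1.1 + ω.1.2) := by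
    rw [localSum, Fintype.sum_prod_type, Fintype.sum_prod_type]
    refine Finset.sum_congr rfl fun u _ => Finset.sum_congr rfl fun v _ => ?_
    simp only [Fintype.sum_prod_type]
    generalize conv μ P' u = A
    generalize conv μ Q' v = B
    generalize conv μ R' (u + v) = C
    rw [conv, conv, conv, Finset.sum_mul_sum]
    simp only [Finset.sum_mul]
    refine Finset.sum_congr rfl fun h _ => Finset.sum_congr rfl fun k _ => ?_
    simp only [Finset.mul_sum, Finset.sum_mul]
    refine Finset.sum_congr rfl fun l _ => ?_
    ring
  have hcP := fun x => hμ.conv_mem hP' x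
  have hcQ := fun x => hμ.conv_mem hQ' x
  have hcR := fun x => hμ.conv_mem hR' x
  have hneg : ∀ x, μ x ≠ 0 → μ (-x) ≠ 0 := fun x hx => by rwa [hμ.symm]
  have l1 := localSum_le_of_shift hμ hδ up lp ip (fun u _ => u) (fun d => d.2.2)
    (fun d => -d.2.1) (fun F => by simp [Finset.mul_sum])
    (fun d _ h2 h3 => ⟨h3, hneg _ h2⟩)
  have l2 := localSum_le_of_shift hμ hδ uq lq iq (fun _ v => v) (fun d => d.2.2)
    (fun d => -d.1) (fun F => by simp) (fun d h1 _ h3 => ⟨h3, hneg _ h1⟩)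
  have l3 := localSum_le_of_shift hμ hδ ur lr ir (fun u v => u + v) (fun d => d.1)
    (fun d => d.2.1) (fun F => by
      have : ∀ u : G, ∑ v, F (u + v) = ∑ x, F x := fun u => Equiv.sum_comp (Equiv.addLeft u) F
      simp [this]) (fun d h1 h2 _ => ⟨h1, h2⟩)
  have step2 : |lineSum (conv μ (conv μ μ)) (sixProd P Q R p q r)
      - ∑ u, ∑ v, conv μ P u * conv μ Q v * conv μ R (u + v)
        * conv μ P' u * conv μ Q' v * conv μ R' (u + v)|
      ≤ 18 * δ * (Fintype.card G : ℝ) ^ 2 := by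
    rw [hprod, lineSum_eq_localSum, localSum, localSum, ← Finset.sum_sub_distrib]
    have hsum := add_le_add (add_le_add l1 l2) l3
    rw [localSum, localSum, localSum, ← Finset.sum_add_distrib, ← Finset.sum_add_distrib] at hsum
    refine (Finset.abs_sum_le_sum_abs _ _).trans ((Finset.sum_le_sum fun ω _ => ?_).trans
      (hsum.trans_eq (by ring)))
    rw [← mul_sub, ← mul_add, ← mul_add, abs_mul, abs_of_nonneg
      (mul_nonneg (mul_nonneg (hμ.nonneg _) (hμ.nonneg _)) (hμ.nonneg _))]
    refine mul_le_mul_of_nonneg_left ?_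
      (mul_nonneg (mul_nonneg (hμ.nonneg _) (hμ.nonneg _)) (hμ.nonneg _))
    have g1 : ω.1.1 + ω.1.2 + ω.2.2.2 - (ω.1.2 + ω.2.2.1) = ω.1.1 + ω.2.2.2 + -ω.2.2.1 := by abel
    have g2 : ω.1.1 + ω.1.2 + ω.2.2.2 - (ω.1.1 + ω.2.1) = ω.1.2 + ω.2.2.2 + -ω.2.1 := by abel
    have g3 : ω.1.1 + ω.2.1 + (ω.1.2 + ω.2.2.1) = ω.1.1 + ω.1.2 + ω.2.1 + ω.2.2.1 := by abel
    rw [sixProd, g1, g2, g3]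
    exact abs_mul_three_sub_le (mul_mem_unit (mul_mem_unit (hP _) (hQ _)) (hR _)) (bp _) (bq _)
      (hcQ _) (hcR _)
  have := abs_sub_le (lineSum (conv μ (conv μ μ)) (sixProd P Q R P' Q' R'))
    (lineSum (conv μ (conv μ μ)) (sixProd P Q R p q r))
    (∑ u, ∑ v, conv μ P u * conv μ Q v * conv μ R (u + v)
        * conv μ P' u * conv μ Q' v * conv μ R' (u + v))
  linarith

end SixForm

/-! ### Reduction of the corner count to a finite model -/

open Classical in
/-- The indicator function of the colour class `i`. -/
noncomputable def colorInd {X κ : Type} (C : X → κ) (i : κ) (x : X) : ℝ := if C x = i then 1 else 0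

lemma colorInd_mem {X κ : Type} (C : X → κ) (i : κ) (x : X) : colorInd C i x ∈ Icc (0 : ℝ) 1 := by
  classical
  simp only [colorInd]
  split_ifs <;> norm_num

lemma colorInd_self {X κ : Type} (C : X → κ) (x : X) : colorInd C (C x) x = 1 := by
  simp [colorInd]

lemma colorInd_of_ne {X κ : Type} (C : X → κ) {i : κ} {x : X} (h : C x ≠ i) :
    colorInd C i x = 0 := by
  simp [colorInd, h]

section Count

variable {G : Type} [AddCommGroup G] [Fintype G]

/-- The product of the values of `f` at the three points in which the lines `a`, `b`, `c` meet;
these points form a corner of difference `c - a - b`. -/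
def cornerProd (f : G × G → ℝ) (a b c : G) : ℝ := f (a, b) * f (a, c - a) * f (c - b, b)

variable {ν : G → ℝ} {t : AddChar G ℂ → ℝ}

/-- Under the weights `ν (c - a - b)`, each of the three points of a corner is uniformly
distributed; this and the next two lemmas treat the points one by one. -/
lemma IsKernel.lineSum_left (hν : IsKernel ν t) (w : G × G → ℝ) :
    (lineSum ν fun a b _ => w (a, b)) = ∑ ω, w ω := by
  rw [Fintype.sum_prod_type]
  refine Finset.sum_congr rfl fun a _ => Finset.sum_congr rfl fun b _ => ?_
  rw [← Finset.sum_mul]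
  have : ∑ c, ν (c - a - b) = 1 := by
    rw [← hν.sum_eq_one, ← Equiv.sum_comp (Equiv.subRight (a + b)) ν]
    simp [sub_sub]
  rw [this, one_mul]

lemma IsKernel.lineSum_mid (hν : IsKernel ν t) (w : G × G → ℝ) :
    (lineSum ν fun a _ c => w (a, c - a)) = ∑ ω, w ω := by
  rw [Fintype.sum_prod_type, lineSum_eq_mid]
  refine Finset.sum_congr rfl fun a _ => ?_
  rw [← Equiv.sum_comp (Equiv.subRight a) (fun y => w (a, y))]
  refine Finset.sum_congr rfl fun c _ => ?_
  rw [← Finset.sum_mul]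
  have : ∑ b, ν (c - a - b) = 1 := by
    rw [← hν.sum_eq_one, ← Equiv.sum_comp (Equiv.subLeft (c - a)) ν]
    rfl
  rw [this, one_mul]
  rfl

lemma IsKernel.lineSum_right (hν : IsKernel ν t) (w : G × G → ℝ) :
    (lineSum ν fun _ b c => w (c - b, b)) = ∑ ω, w ω := by
  rw [Fintype.sum_prod_type_right, lineSum_eq_right]
  refine Finset.sum_congr rfl fun b _ => ?_
  rw [← Equiv.sum_comp (Equiv.subRight b) (fun x => w (x, b))]
  refine Finset.sum_congr rfl fun c _ => ?_
  rw [← Finset.sum_mul]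
  have : ∑ a, ν (c - a - b) = 1 := by
    rw [← hν.sum_eq_one, ← Equiv.sum_comp (Equiv.subLeft (c - b)) ν]
    refine Finset.sum_congr rfl fun a _ => ?_
    rw [sub_right_comm]; rfl
  rw [this, one_mul]
  rfl

/-- Replacing `f` by its structured approximation hardly changes the corner count. -/
lemma IsKernel.abs_lineSum_cornerProd_sub_le (hν : IsKernel ν t) {f g e : G × G → ℝ}
    (hf : ∀ ω, f ω ∈ Icc (0 : ℝ) 1) (hg : ∀ ω, g ω ∈ Icc (0 : ℝ) 1)
    (he : ∀ ω, e ω ∈ Icc (0 : ℝ) 1) (E : ℝ) (hcut : CutSmall (fun ω => f ω - g ω) E) :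
    |lineSum ν (cornerProd f) - lineSum ν (cornerProd e)|
      ≤ 3 * ((∑ γ, t γ) * E) + 3 * ∑ ω, |g ω - e ω| := by
  obtain ⟨c1, c2, c3⟩ := hcut
  have e1 := hν.abs_lineSum_le_left _ (fun a c => f (a, c - a)) (fun b c => f (c - b, b)) E c1
    (fun _ _ => abs_le_one_of_mem (hf _)) (fun _ _ => abs_le_one_of_mem (hf _))
  have e2 := hν.abs_lineSum_le_mid _ (fun a b => g (a, b)) (fun c b => f (c - b, b)) E c2
    (fun _ _ => abs_le_one_of_mem (hg _)) (fun _ _ => abs_le_one_of_mem (hf _))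
  have e3 := hν.abs_lineSum_le_right _ (fun b a => g (a, b)) (fun c a => g (a, c - a)) E c3
    (fun _ _ => abs_le_one_of_mem (hg _)) (fun _ _ => abs_le_one_of_mem (hg _))
  have hs : lineSum ν (cornerProd f) - lineSum ν (cornerProd g)
      = (lineSum ν fun a b c => (f (a, b) - g (a, b)) * f (a, c - a) * f (c - b, b))
        + (lineSum ν fun a b c => (f (a, c - a) - g (a, c - a)) * g (a, b) * f (c - b, b))
        + (lineSum ν fun a b c => (f (c - b, b) - g (c - b, b)) * g (a, b) * g (a, c - a)) := by
    rw [lineSum_sub]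
    simp only [lineSum, ← Finset.sum_add_distrib, cornerProd]
    refine Finset.sum_congr rfl fun a _ => Finset.sum_congr rfl fun b _ =>
      Finset.sum_congr rfl fun c _ => ?_
    ring
  have step1 : |lineSum ν (cornerProd f) - lineSum ν (cornerProd g)| ≤ 3 * ((∑ γ, t γ) * E) := by
    rw [hs]
    refine (abs_add_le _ _).trans ((add_le_add_left (abs_add_le _ _) _).trans ?_)
    linarith
  have step2 : |lineSum ν (cornerProd g) - lineSum ν (cornerProd e)|
      ≤ 3 * ∑ ω, |g ω - e ω| := by
    have h1 : 3 * ∑ ω, |g ω - e ω| = lineSum ν fun a b c => |g (a, b) - e (a, b)|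
        + |g (a, c - a) - e (a, c - a)| + |g (c - b, b) - e (c - b, b)| := by
      have l1 := hν.lineSum_left fun ω => |g ω - e ω|
      have l2 := hν.lineSum_mid fun ω => |g ω - e ω|
      have l3 := hν.lineSum_right fun ω => |g ω - e ω|
      have : (3 : ℝ) * ∑ ω, |g ω - e ω|
          = ∑ ω, |g ω - e ω| + ∑ ω, |g ω - e ω| + ∑ ω, |g ω - e ω| := by ring
      rw [this]
      nth_rewrite 1 [← l1]
      nth_rewrite 1 [← l2]
      rw [← l3]
      simp only [lineSum, ← Finset.sum_add_distrib, ← mul_add]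
    rw [h1, lineSum_sub]
    refine (Finset.abs_sum_le_sum_abs _ _).trans (Finset.sum_le_sum fun a _ => ?_)
    refine (Finset.abs_sum_le_sum_abs _ _).trans (Finset.sum_le_sum fun b _ => ?_)
    refine (Finset.abs_sum_le_sum_abs _ _).trans (Finset.sum_le_sum fun c _ => ?_)
    rw [abs_mul, abs_of_nonneg (hν.nonneg _)]
    refine mul_le_mul_of_nonneg_left ?_ (hν.nonneg _)
    have := abs_mul_three_sub_le (X := 1) (by norm_num) (hg (a, b)) (hg (a, c - a))
      (he (a, c - a)) (he (c - b, b)) (A₃ := g (c - b, b)) (B₁ := e (a, b))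
    simpa only [one_mul, cornerProd] using this
  have := abs_sub_le (lineSum ν (cornerProd f)) (lineSum ν (cornerProd g))
    (lineSum ν (cornerProd e))
  linarith

lemma lineSum_sum {I : Type} [Fintype I] (ν : G → ℝ) (w : I → ℝ) (Ψ : I → G → G → G → ℝ) :
    (lineSum ν fun a b c => ∑ i, w i * Ψ i a b c) = ∑ i, w i * lineSum ν (Ψ i) := by
  simp only [lineSum, Finset.mul_sum]
  refine Eq.trans ?_ Finset.sum_comm
  refine Finset.sum_congr rfl fun a _ => ?_
  refine Eq.trans ?_ Finset.sum_comm
  refine Finset.sum_congr rfl fun b _ => ?_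
  refine Eq.trans ?_ Finset.sum_comm
  refine Finset.sum_congr rfl fun c _ => Finset.sum_congr rfl fun i _ => ?_
  ring

/-- The value of `T` at the step function with values `Φ` whose steps have the weights `p`, `q`,
`r` in the three directions, as a sum over six indices. -/
def sixSum {κ : Type} [Fintype κ] (Φ : κ × κ × κ → ℝ) (p q r : κ → ℝ) : ℝ :=
  ∑ i : (κ × κ × κ) × (κ × κ × κ),
    (Φ (i.1.1, i.1.2.1, i.2.2.2) * Φ (i.1.1, i.2.2.1, i.1.2.2) * Φ (i.2.1, i.1.2.1, i.1.2.2)) *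
      (p i.1.1 * q i.1.2.1 * r i.1.2.2 * p i.2.1 * q i.2.2.1 * r i.2.2.2)

/-- The mean of the step function with values `Φ` whose steps have the weights `p`, `q`, `r`. -/
def meanSum {κ : Type} [Fintype κ] (Φ : κ × κ × κ → ℝ) (p q r : κ → ℝ) : ℝ :=
  ∑ j : κ × κ × κ, Φ j * (p j.1 * q j.2.1 * r j.2.2)

/-- A function of the colours is a combination of products of indicators of colour classes. -/
lemma lineSum_cornerProd_pairColor {κ : Type} [Fintype κ] (ν : G → ℝ) (C : G → κ)
    (Φ : κ × κ × κ → ℝ) :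
    lineSum ν (cornerProd fun ω => Φ (pairColor C ω))
      = ∑ i : (κ × κ × κ) × (κ × κ × κ),
        (Φ (i.1.1, i.1.2.1, i.2.2.2) * Φ (i.1.1, i.2.2.1, i.1.2.2)
          * Φ (i.2.1, i.1.2.1, i.1.2.2)) *
        lineSum ν (sixProd (colorInd C i.1.1) (colorInd C i.1.2.1) (colorInd C i.1.2.2)
          (colorInd C i.2.1) (colorInd C i.2.2.1) (colorInd C i.2.2.2)) := by
  classical
  rw [← lineSum_sum]
  congr 1
  funext a b c
  rw [Fintype.sum_eq_single ((C a, C b, C c), (C (c - b), C (c - a), C (a + b)))]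
  · simp [cornerProd, pairColor, sixProd, colorInd_self]
  · rintro ⟨⟨i, j, k⟩, ⟨i', j', k'⟩⟩ hne
    refine mul_eq_zero_of_right _ ?_
    simp only [sixProd]
    by_cases h1 : C a = i
    swap
    · simp [colorInd_of_ne C h1]
    by_cases h2 : C b = j
    swap
    · simp [colorInd_of_ne C h2]
    by_cases h3 : C c = k
    swap
    · simp [colorInd_of_ne C h3]
    by_cases h4 : C (c - b) = i'
    swap
    · simp [colorInd_of_ne C h4]
    by_cases h5 : C (c - a) = j'
    swap
    · simp [colorInd_of_ne C h5]
    by_cases h6 : C (a + b) = k'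
    swap
    · simp [colorInd_of_ne C h6]
    exact absurd (by rw [h1, h2, h3, h4, h5, h6]) hne

lemma IsKernel.sum_pairColor (hν : IsKernel ν t) {κ : Type} [Fintype κ] (C : G → κ)
    (Φ : κ × κ × κ → ℝ) :
    ∑ ω, Φ (pairColor C ω) = ∑ j : κ × κ × κ, Φ j *
      lineSum ν (sixProd (colorInd C j.1) (colorInd C j.2.1) (fun _ => 1) (fun _ => 1)
        (fun _ => 1) (colorInd C j.2.2)) := by
  classical
  rw [← lineSum_sum, ← hν.lineSum_left]
  congr 1
  funext a b c
  rw [Fintype.sum_eq_single (C a, C b, C (a + b))]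
  · simp [pairColor, sixProd, colorInd_self]
  · rintro ⟨i, j, k⟩ hne
    refine mul_eq_zero_of_right _ ?_
    simp only [sixProd]
    by_cases h1 : C a = i
    swap
    · simp [colorInd_of_ne C h1]
    by_cases h2 : C b = j
    swap
    · simp [colorInd_of_ne C h2]
    by_cases h6 : C (a + b) = k
    swap
    · simp [colorInd_of_ne C h6]
    exact absurd (by rw [h1, h2, h6]) hne

lemma IsKernel.conv_one (hν : IsKernel ν t) (x : G) : PopularCorners.conv ν (fun _ => 1) x = 1 := by
  simp [PopularCorners.conv, hν.sum_eq_one]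

lemma regularFor_one (ν : G → ℝ) (t : AddChar G ℂ → ℝ) {δ : ℝ} (hδ : 0 ≤ δ) :
    RegularFor ν t δ fun _ => 1 :=
  ⟨fun _ => 1, fun _ => 1, fun _ => by norm_num, fun _ => by norm_num,
    ⟨0, by simpa using hδ, fun γ => by simp [ft]⟩, by simp; positivity, fun h _ => by
      simp; positivity⟩

/-- For colours that are regular for `μ`, the corner count of a function of the colours of `x`,
`y`, `x + y` and its mean are governed by the local densities of the colours. -/
lemma abs_lineSum_pairColor_sub_le {μ : G → ℝ} (hμ : IsKernel μ t) {δ : ℝ} (hδ : 0 ≤ δ)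
    {κ : Type} [Fintype κ] (C : G → κ) (Φ : κ × κ × κ → ℝ) (hΦ : ∀ j, Φ j ∈ Icc (0 : ℝ) 1)
    (hreg : ∀ i, RegularFor μ t δ (colorInd C i)) (K : ℕ) (hK : Fintype.card κ ≤ K) :
    |lineSum (conv μ (conv μ μ)) (cornerProd fun ω => Φ (pairColor C ω))
      - ∑ u, ∑ v, sixSum Φ (fun i => conv μ (colorInd C i) u) (fun i => conv μ (colorInd C i) v)
        (fun i => conv μ (colorInd C i) (u + v))|
      ≤ (K + 1 : ℝ) ^ 6 * (21 * δ * (Fintype.card G : ℝ) ^ 2) ∧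
    |∑ ω, Φ (pairColor C ω)
      - ∑ u, ∑ v, meanSum Φ (fun i => conv μ (colorInd C i) u) (fun i => conv μ (colorInd C i) v)
        (fun i => conv μ (colorInd C i) (u + v))|
      ≤ (K + 1 : ℝ) ^ 6 * (21 * δ * (Fintype.card G : ℝ) ^ 2) := by
  have hKr : (Fintype.card κ : ℝ) ≤ K + 1 := by
    have : (Fintype.card κ : ℝ) ≤ K := by exact_mod_cast hK
    linarith
  have hm := colorInd_mem C
  have hswap : ∀ {I : Type} [Fintype I] (w : I → ℝ) (F : I → G → G → ℝ),
      ∑ u, ∑ v, ∑ i, w i * F i u v = ∑ i, w i * ∑ u, ∑ v, F i u v := by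
    intro I _ w F
    simp only [Finset.mul_sum]
    refine Eq.trans ?_ Finset.sum_comm
    refine Finset.sum_congr rfl fun u _ => ?_
    exact Finset.sum_comm
  constructor
  · rw [lineSum_cornerProd_pairColor]
    simp only [sixSum]
    rw [hswap (fun i : (κ × κ × κ) × (κ × κ × κ) => Φ (i.1.1, i.1.2.1, i.2.2.2)
      * Φ (i.1.1, i.2.2.1, i.1.2.2) * Φ (i.2.1, i.1.2.1, i.1.2.2)) (fun i u v =>
      conv μ (colorInd C i.1.1) u * conv μ (colorInd C i.1.2.1) v
        * conv μ (colorInd C i.1.2.2) (u + v) * conv μ (colorInd C i.2.1) u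
        * conv μ (colorInd C i.2.2.1) v * conv μ (colorInd C i.2.2.2) (u + v)),
      ← Finset.sum_sub_distrib]
    refine (Finset.abs_sum_le_sum_abs _ _).trans ((Finset.sum_le_sum (g := fun _ =>
      21 * δ * (Fintype.card G : ℝ) ^ 2) fun i _ => ?_).trans ?_)
    · rw [← mul_sub, abs_mul]
      refine (mul_le_of_le_one_left (abs_nonneg _) (abs_le_one_of_mem
        (mul_mem_unit (mul_mem_unit (hΦ _) (hΦ _)) (hΦ _)))).trans ?_
      exact abs_lineSum_sixProd_sub_le hμ hδ (hm _) (hm _) (hm _) (hm _) (hm _) (hm _)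
        (hreg _) (hreg _) (hreg _)
    · rw [Finset.sum_const, nsmul_eq_mul, Finset.card_univ]
      refine mul_le_mul_of_nonneg_right ?_ (by positivity)
      simp only [Fintype.card_prod]
      push_cast
      calc _ = (Fintype.card κ : ℝ) ^ 6 := by ring
        _ ≤ _ := by gcongr
  · rw [(hμ.conv (hμ.conv hμ)).sum_pairColor]
    simp only [meanSum]
    rw [hswap Φ (fun j u v => conv μ (colorInd C j.1) u * conv μ (colorInd C j.2.1) v
        * conv μ (colorInd C j.2.2) (u + v)), ← Finset.sum_sub_distrib]
    refine (Finset.abs_sum_le_sum_abs _ _).trans ((Finset.sum_le_sum (g := fun _ =>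
      21 * δ * (Fintype.card G : ℝ) ^ 2) fun i _ => ?_).trans ?_)
    · rw [← mul_sub, abs_mul]
      refine (mul_le_of_le_one_left (abs_nonneg _) (abs_le_one_of_mem (hΦ _))).trans ?_
      have h1 : ∀ _x : G, (1 : ℝ) ∈ Icc (0 : ℝ) 1 := fun _ => by norm_num
      have := abs_lineSum_sixProd_sub_le hμ hδ (hm i.1) (hm i.2.1) h1 h1 h1 (hm i.2.2)
        (regularFor_one _ _ hδ) (regularFor_one _ _ hδ) (hreg i.2.2)
      simpa only [hμ.conv_one, mul_one] using this
    · rw [Finset.sum_const, nsmul_eq_mul, Finset.card_univ]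
      refine mul_le_mul_of_nonneg_right ?_ (by positivity)
      simp only [Fintype.card_prod]
      push_cast
      calc _ = (Fintype.card κ : ℝ) ^ 3 := by ring
        _ ≤ (K + 1 : ℝ) ^ 3 := by gcongr
        _ ≤ _ := pow_le_pow_right₀ (by linarith [(Nat.cast_nonneg K : (0 : ℝ) ≤ K)])
          (by norm_num)

end Count

/-- The corner count of `f`, averaged over the difference with a kernel of bounded complexity, is
close to an average of values of `T` at step functions, whose means average to the mean of `f`. -/
theorem exists_kernel_corner_count (ε : ℝ) (hε : 0 < ε) : ∃ M : ℝ,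
    ∀ (G : Type) [AddCommGroup G] [Fintype G] (γ₁ : AddChar G ℂ) (f : G × G → ℝ),
    (∀ ω, f ω ∈ Icc (0 : ℝ) 1) →
    ∃ (ν : G → ℝ) (t : AddChar G ℂ → ℝ), IsKernel ν t ∧ ∑ γ, t γ ≤ M ∧ 1 - t γ₁ ≤ ε ∧
    ∃ (κ : Type) (_ : Fintype κ) (Φ : κ × κ × κ → ℝ) (p : κ → G → ℝ),
      (∀ j, Φ j ∈ Icc (0 : ℝ) 1) ∧ (∀ i x, 0 ≤ p i x) ∧ (∀ x, ∑ i, p i x = 1) ∧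
      |lineSum ν (cornerProd f)
        - ∑ u, ∑ v, sixSum Φ (fun i => p i u) (fun i => p i v) (fun i => p i (u + v))|
        ≤ ε * (Fintype.card G : ℝ) ^ 2 ∧
      |∑ ω, f ω
        - ∑ u, ∑ v, meanSum Φ (fun i => p i u) (fun i => p i v) (fun i => p i (u + v))|
        ≤ ε * (Fintype.card G : ℝ) ^ 2 := by
  classical
  -- `δ K` is chosen so that the errors for all six-tuples of `K` colours add up to at most `ε / 2`
  let δ : ℕ → ℝ := fun K => ε / (42 * (K + 1 : ℝ) ^ 6)
  have hδ : ∀ K, 0 < δ K := fun K => by positivity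
  have hδ1 : ∀ K : ℕ, (K + 1 : ℝ) ^ 6 * (21 * δ K) = ε / 2 := fun K => by
    simp only [δ]; field_simp; norm_num
  have hδ2 : ∀ K : ℕ, 3 * δ K ≤ ε := fun K => by
    have h1 : (1 : ℝ) ≤ (K + 1 : ℝ) ^ 6 :=
      one_le_pow₀ (by linarith [(Nat.cast_nonneg K : (0 : ℝ) ≤ K)])
    have := hδ1 K
    nlinarith [hδ K]
  choose M hM1 hM using fun K => exists_regular_kernel K (δ K) (hδ K)
  have hMpos : ∀ K, 0 < M K := fun K => lt_of_lt_of_le one_pos (hM1 K)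
  obtain ⟨Kmax, hKmax⟩ := strong_regularity ((ε / 12) ^ 2) (by positivity)
    (fun K => ε / (12 * M K)) (fun K => by have := hMpos K; positivity)
  refine ⟨∑ K ∈ Finset.range (Kmax + 1), M K, fun G _ _ γ₁ f hf => ?_⟩
  have hN : (0 : ℝ) < Fintype.card G := by exact_mod_cast Fintype.card_pos
  obtain ⟨K, κ, _, C, g, hK, hcard, hg, hge, hcut⟩ := hKmax G f hf
  obtain ⟨μ, t, hμ, hMμ, hγ₁, hreg⟩ := hM K G γ₁ κ (colorInd C) hcard (colorInd_mem C)
  have hν := hμ.conv (hμ.conv hμ)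
  have hcube : ∀ γ, t γ * (t γ * t γ) ≤ t γ := fun γ =>
    mul_le_of_le_one_right (hμ.ft_nonneg γ)
      (mul_le_one₀ (hμ.ft_le_one γ) (hμ.ft_nonneg γ) (hμ.ft_le_one γ))
  have hcubes : ∑ γ, t γ * (t γ * t γ) ≤ M K :=
    (Finset.sum_le_sum fun γ _ => hcube γ).trans hMμ
  have hΦ := cellAvg_mem f hf (pairColor C)
  obtain ⟨c1, c2⟩ := abs_lineSum_pairColor_sub_le hμ (hδ K).le C (cellAvg f (pairColor C)) hΦ
    hreg K hcard
  refine ⟨conv μ (conv μ μ), _, hν, hcubes.trans (Finset.single_le_sum (f := M)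
    (fun K _ => (hMpos K).le) (Finset.mem_range.mpr (by omega))), ?_, κ, inferInstance,
    cellAvg f (pairColor C), fun i => conv μ (colorInd C i), hΦ,
    fun i x => (hμ.conv_mem (colorInd_mem C i) x).1, fun x => ?_, ?_, ?_⟩
  · have h0 := hμ.ft_nonneg γ₁
    have h1 := hμ.ft_le_one γ₁
    have : 1 - t γ₁ * (t γ₁ * t γ₁) ≤ 3 * (1 - t γ₁) := by
      nlinarith [mul_nonneg (add_nonneg h0 zero_le_two) (sq_nonneg (1 - t γ₁))]
    linarith [hδ2 K]
  · simp only [conv]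
    rw [Finset.sum_comm, ← hμ.sum_eq_one]
    refine Finset.sum_congr rfl fun h _ => ?_
    rw [← Finset.mul_sum, Fintype.sum_eq_single (C (x + h)), colorInd_self, mul_one]
    exact fun i hi => colorInd_of_ne C hi.symm
  · have h1 := hν.abs_lineSum_cornerProd_sub_le hf hg (fun ω => hΦ (pairColor C ω)) _ hcut
    have h2 : (∑ γ, t γ * (t γ * t γ)) * (ε / (12 * M K) * (Fintype.card G : ℝ) ^ 2)
        ≤ ε / 12 * (Fintype.card G : ℝ) ^ 2 := by
      calc _ ≤ M K * (ε / (12 * M K) * (Fintype.card G : ℝ) ^ 2) := by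
            have := hMpos K
            exact mul_le_mul_of_nonneg_right hcubes (by positivity)
        _ = _ := by have := (hMpos K).ne'; field_simp
    have h3 : ∑ ω, |g ω - cellAvg f (pairColor C) (pairColor C ω)|
        ≤ ε / 12 * (Fintype.card G : ℝ) ^ 2 := by
      refine abs_le_of_sq_le_sq' ?_ (by positivity) |>.2
      have h4 := sq_sum_le_card_mul_sum_sq (s := (Finset.univ : Finset (G × G)))
        (f := fun ω => |g ω - cellAvg f (pairColor C) (pairColor C ω)|)
      simp only [sq_abs, Finset.card_univ, Fintype.card_prod] at h4
      push_cast at h4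
      have h5 := mul_le_mul_of_nonneg_left hge (mul_pos hN hN).le
      linarith
    have h4 := abs_sub_le (lineSum (conv μ (conv μ μ)) (cornerProd f))
      (lineSum (conv μ (conv μ μ)) (cornerProd fun ω => cellAvg f (pairColor C) (pairColor C ω)))
      (∑ u, ∑ v, sixSum (cellAvg f (pairColor C)) (fun i => conv μ (colorInd C i) u)
        (fun i => conv μ (colorInd C i) v) (fun i => conv μ (colorInd C i) (u + v)))
    have h5 : (K + 1 : ℝ) ^ 6 * (21 * δ K * (Fintype.card G : ℝ) ^ 2)
        = ε / 2 * (Fintype.card G : ℝ) ^ 2 := by rw [← mul_assoc, hδ1]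
    linarith
  · rw [sum_cellAvg] at c2
    have h5 : (K + 1 : ℝ) ^ 6 * (21 * δ K * (Fintype.card G : ℝ) ^ 2)
        = ε / 2 * (Fintype.card G : ℝ) ^ 2 := by rw [← mul_assoc, hδ1]
    have h6 : 0 ≤ ε * (Fintype.card G : ℝ) ^ 2 := by positivity
    linarith

/-! ### Step functions on the unit cube -/

section Step

variable {κ : Type} [Fintype κ]

/-- Finitely many weights of sum `1` are the lengths of the steps of a measurable function on
`[0,1]`. -/
lemma exists_step [MeasurableSpace κ] [DiscreteMeasurableSpace κ] (p : κ → ℝ)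
    (hp : ∀ i, 0 ≤ p i) (hp1 : ∑ i, p i = 1) :
    ∃ X : unitInterval → κ, Measurable X ∧ ∀ F : κ → ℝ, ∫ x, F (X x) = ∑ i, p i * F i := by
  classical
  have hne : Nonempty κ := by
    by_contra h
    rw [not_nonempty_iff] at h
    simp at hp1
  let μ : Measure κ := ∑ i, ENNReal.ofReal (p i) • Measure.dirac i
  have hμ : IsProbabilityMeasure μ := by
    constructor
    simp only [μ, Measure.coe_finsetSum, Finset.sum_apply, Measure.smul_apply, measure_univ,
      smul_eq_mul, mul_one]
    rw [← ENNReal.ofReal_sum_of_nonneg fun i _ => hp i, hp1, ENNReal.ofReal_one]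
  obtain ⟨X, hX, hXμ⟩ := μ.exists_measurable_map_eq
  refine ⟨X, hX, fun F => ?_⟩
  rw [← integral_map hX.aemeasurable (Measurable.of_discrete.aestronglyMeasurable), hXμ,
    integral_finsetSum_measure fun i _ => by
      have := Measure.smul_finite (Measure.dirac i) (ENNReal.ofReal_ne_top (r := p i))
      exact Integrable.of_finite]
  refine Finset.sum_congr rfl fun i _ => ?_
  rw [integral_smul_measure, integral_dirac, ENNReal.toReal_ofReal (hp i), smul_eq_mul]

lemma sixSum_eq (Φ : κ × κ × κ → ℝ) (p q r : κ → ℝ) :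
    sixSum Φ p q r = ∑ j : κ × κ × κ, ((∑ k', r k' * Φ (j.1, j.2.1, k')) *
      (∑ j', q j' * Φ (j.1, j', j.2.2)) * (∑ i', p i' * Φ (i', j.2.1, j.2.2))) *
      (p j.1 * q j.2.1 * r j.2.2) := by
  rw [sixSum, Fintype.sum_prod_type]
  refine Finset.sum_congr rfl fun j _ => ?_
  have h : ∀ a b c : κ → ℝ, ∑ l : κ × κ × κ, a l.2.2 * b l.2.1 * c l.1
      = (∑ k, a k) * (∑ j, b j) * ∑ i, c i := fun a b c => by
    simp only [Fintype.sum_prod_type, ← Finset.sum_mul, ← Finset.mul_sum]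
  rw [← h, Finset.sum_mul]
  refine Finset.sum_congr rfl fun l _ => ?_
  ring

/-- The step functions with values `Φ` realise the means `meanSum` and the values `sixSum` of
`T`. -/
lemma exists_admissible_T_eq (Φ : κ × κ × κ → ℝ) (hΦ : ∀ j, Φ j ∈ Icc (0 : ℝ) 1)
    {p q r : κ → ℝ} (hp : ∀ i, 0 ≤ p i) (hq : ∀ i, 0 ≤ q i) (hr : ∀ i, 0 ≤ r i)
    (hp1 : ∑ i, p i = 1) (hq1 : ∑ i, q i = 1) (hr1 : ∑ i, r i = 1) :
    ∃ φ ∈ Admissible (meanSum Φ p q r), T φ = sixSum Φ p q r := by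
  classical
  let _ : MeasurableSpace κ := ⊤
  obtain ⟨X, hX, hXi⟩ := exists_step p hp hp1
  obtain ⟨Y, hY, hYi⟩ := exists_step q hq hq1
  obtain ⟨Z, hZ, hZi⟩ := exists_step r hr hr1
  let W : unitInterval × unitInterval × unitInterval → κ × κ × κ :=
    fun w => (X w.1, Y w.2.1, Z w.2.2)
  have hW : Measurable W := (hX.comp measurable_fst).prodMk
    ((hY.comp (measurable_fst.comp measurable_snd)).prodMk
      (hZ.comp (measurable_snd.comp measurable_snd)))
  have hint : ∀ H : κ × κ × κ → ℝ, Integrable fun w => H (W w) := fun H =>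
    (Integrable.of_finite (μ := volume.map W) (f := H)).comp_measurable hW
  have htriple : ∀ H : κ × κ × κ → ℝ,
      ∫ w, H (W w) = ∑ j : κ × κ × κ, H j * (p j.1 * q j.2.1 * r j.2.2) := by
    intro H
    have h2 : ∀ x : unitInterval, ∫ w : unitInterval × unitInterval, H (X x, Y w.1, Z w.2)
        = ∑ j, q j * ∑ k, r k * H (X x, j, k) := by
      intro x
      have hint2 : Integrable fun w : unitInterval × unitInterval => H (X x, Y w.1, Z w.2) :=
        (Integrable.of_finite (μ := volume.map fun w : unitInterval × unitInterval =>
          (Y w.1, Z w.2)) (f := fun j : κ × κ => H (X x, j))).comp_measurable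
          ((hY.comp measurable_fst).prodMk (hZ.comp measurable_snd))
      rw [Measure.volume_eq_prod, integral_prod _ hint2, ← hYi]
      refine integral_congr_ae (ae_of_all _ fun y => ?_)
      exact hZi fun k => H (X x, Y y, k)
    have h3 : ∫ w, H (W w) = ∫ x, ∫ w : unitInterval × unitInterval, H (X x, Y w.1, Z w.2) := by
      rw [Measure.volume_eq_prod]
      exact integral_prod _ (hint H)
    rw [h3]
    simp_rw [h2]
    rw [hXi fun i => ∑ j, q j * ∑ k, r k * H (i, j, k)]
    simp only [Fintype.sum_prod_type, Finset.mul_sum]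
    refine Finset.sum_congr rfl fun i _ => Finset.sum_congr rfl fun j _ =>
      Finset.sum_congr rfl fun k _ => ?_
    ring
  refine ⟨fun w => Φ (W w), ⟨Measurable.of_discrete.comp hW, fun w => hΦ _, htriple Φ⟩, ?_⟩
  rw [T, sixSum_eq, ← htriple]
  refine integral_congr_ae (ae_of_all _ fun w => ?_)
  simp only [W]
  rw [hZi fun k => Φ (X w.1, Y w.2.1, k), hYi fun j => Φ (X w.1, j, Z w.2.2),
    hXi fun i => Φ (i, Y w.2.1, Z w.2.2)]

lemma T_nonneg {φ : unitInterval × unitInterval × unitInterval → ℝ} (h : ∀ w, 0 ≤ φ w) :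
    0 ≤ T φ :=
  integral_nonneg fun _ => mul_nonneg (mul_nonneg (integral_nonneg fun _ => h _)
    (integral_nonneg fun _ => h _)) (integral_nonneg fun _ => h _)

lemma bddBelow_T_image (α : ℝ) : BddBelow (T '' Admissible α) :=
  ⟨0, by rintro _ ⟨φ, hφ, rfl⟩; exact T_nonneg fun w => (hφ.2.1 w).1⟩

lemma m_nonneg (α : ℝ) : 0 ≤ m α :=
  Real.sInf_nonneg (by rintro _ ⟨φ, hφ, rfl⟩; exact T_nonneg fun w => (hφ.2.1 w).1)

/-- The infimum defining `m` is taken over a set which is bounded below, so it is at most the value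
at a step function. -/
lemma m_meanSum_le (Φ : κ × κ × κ → ℝ) (hΦ : ∀ j, Φ j ∈ Icc (0 : ℝ) 1)
    {p q r : κ → ℝ} (hp : ∀ i, 0 ≤ p i) (hq : ∀ i, 0 ≤ q i) (hr : ∀ i, 0 ≤ r i)
    (hp1 : ∑ i, p i = 1) (hq1 : ∑ i, q i = 1) (hr1 : ∑ i, r i = 1) :
    m (meanSum Φ p q r) ≤ sixSum Φ p q r := by
  obtain ⟨φ, hφ, h⟩ := exists_admissible_T_eq Φ hΦ hp hq hr hp1 hq1 hr1
  rw [← h]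
  exact csInf_le (bddBelow_T_image _) ⟨φ, hφ, rfl⟩

lemma meanSum_mem (Φ : κ × κ × κ → ℝ) (hΦ : ∀ j, Φ j ∈ Icc (0 : ℝ) 1)
    {p q r : κ → ℝ} (hp : ∀ i, 0 ≤ p i) (hq : ∀ i, 0 ≤ q i) (hr : ∀ i, 0 ≤ r i)
    (hp1 : ∑ i, p i = 1) (hq1 : ∑ i, q i = 1) (hr1 : ∑ i, r i = 1) :
    meanSum Φ p q r ∈ Icc (0 : ℝ) 1 := by
  obtain ⟨φ, ⟨h1, h2, h3⟩, -⟩ := exists_admissible_T_eq Φ hΦ hp hq hr hp1 hq1 hr1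
  rw [← h3]
  refine ⟨integral_nonneg fun w => (h2 w).1, ?_⟩
  have : ∫ w, φ w ≤ ∫ _w : unitInterval × unitInterval × unitInterval, (1 : ℝ) := by
    refine integral_mono_of_nonneg (ae_of_all _ fun w => (h2 w).1) (integrable_const _)
      (ae_of_all _ fun w => (h2 w).2)
  simpa using this

lemma sum_weights {p q r : κ → ℝ} (hp1 : ∑ i, p i = 1) (hq1 : ∑ i, q i = 1)
    (hr1 : ∑ i, r i = 1) : ∑ j : κ × κ × κ, p j.1 * q j.2.1 * r j.2.2 = 1 := by
  simp only [Fintype.sum_prod_type, ← Finset.mul_sum, hp1, hq1, hr1, mul_one]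

/-- Increasing `Φ` to `Ψ` increases `sixSum` by at most three times the increase of the mean. -/
lemma sixSum_le_add {Φ Ψ : κ × κ × κ → ℝ} (hΦ : ∀ j, Φ j ∈ Icc (0 : ℝ) 1)
    (hΨ : ∀ j, Ψ j ∈ Icc (0 : ℝ) 1) (hle : ∀ j, Φ j ≤ Ψ j)
    {p q r : κ → ℝ} (hp : ∀ i, 0 ≤ p i) (hq : ∀ i, 0 ≤ q i) (hr : ∀ i, 0 ≤ r i)
    (hp1 : ∑ i, p i = 1) (hq1 : ∑ i, q i = 1) (hr1 : ∑ i, r i = 1) :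
    sixSum Ψ p q r ≤ sixSum Φ p q r + 3 * (meanSum Ψ p q r - meanSum Φ p q r) := by
  let wt : (κ × κ × κ) × (κ × κ × κ) → ℝ := fun i =>
    p i.1.1 * q i.1.2.1 * r i.1.2.2 * p i.2.1 * q i.2.2.1 * r i.2.2.2
  have hmarg : ∀ Δ : κ × κ × κ → ℝ, ∑ i, Δ i.1 * wt i = meanSum Δ p q r := by
    intro Δ
    rw [Fintype.sum_prod_type, meanSum]
    refine Finset.sum_congr rfl fun j _ => ?_
    have : ∀ l : κ × κ × κ, Δ j * wt (j, l)
        = Δ j * (p j.1 * q j.2.1 * r j.2.2) * (p l.1 * q l.2.1 * r l.2.2) := fun l => by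
      simp only [wt]; ring
    simp only [this]
    rw [← Finset.mul_sum, sum_weights hp1 hq1 hr1, mul_one]
  have h1 : ∀ Δ : κ × κ × κ → ℝ, ∑ i : (κ × κ × κ) × (κ × κ × κ),
      Δ (i.1.1, i.1.2.1, i.2.2.2) * wt i = meanSum Δ p q r := fun Δ => by
    rw [← hmarg]
    refine Fintype.sum_equiv ⟨fun i => ((i.1.1, i.1.2.1, i.2.2.2), (i.2.1, i.2.2.1, i.1.2.2)),
      fun i => ((i.1.1, i.1.2.1, i.2.2.2), (i.2.1, i.2.2.1, i.1.2.2)), fun _ => rfl,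
      fun _ => rfl⟩ _ _ fun i => ?_
    simp only [Equiv.coe_fn_mk, wt]; ring
  have h2 : ∀ Δ : κ × κ × κ → ℝ, ∑ i : (κ × κ × κ) × (κ × κ × κ),
      Δ (i.1.1, i.2.2.1, i.1.2.2) * wt i = meanSum Δ p q r := fun Δ => by
    rw [← hmarg]
    refine Fintype.sum_equiv ⟨fun i => ((i.1.1, i.2.2.1, i.1.2.2), (i.2.1, i.1.2.1, i.2.2.2)),
      fun i => ((i.1.1, i.2.2.1, i.1.2.2), (i.2.1, i.1.2.1, i.2.2.2)), fun _ => rfl,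
      fun _ => rfl⟩ _ _ fun i => ?_
    simp only [Equiv.coe_fn_mk, wt]; ring
  have h3 : ∀ Δ : κ × κ × κ → ℝ, ∑ i : (κ × κ × κ) × (κ × κ × κ),
      Δ (i.2.1, i.1.2.1, i.1.2.2) * wt i = meanSum Δ p q r := fun Δ => by
    rw [← hmarg]
    refine Fintype.sum_equiv ⟨fun i => ((i.2.1, i.1.2.1, i.1.2.2), (i.1.1, i.2.2.1, i.2.2.2)),
      fun i => ((i.2.1, i.1.2.1, i.1.2.2), (i.1.1, i.2.2.1, i.2.2.2)), fun _ => rfl,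
      fun _ => rfl⟩ _ _ fun i => ?_
    simp only [Equiv.coe_fn_mk, wt]; ring
  have hwt : ∀ i, 0 ≤ wt i := fun i => by
    have := hp i.1.1; have := hq i.1.2.1; have := hr i.1.2.2
    have := hp i.2.1; have := hq i.2.2.1; have := hr i.2.2.2
    simp only [wt]; positivity
  have key : sixSum Ψ p q r ≤ sixSum Φ p q r
      + (∑ i, Ψ (i.1.1, i.1.2.1, i.2.2.2) * wt i - ∑ i, Φ (i.1.1, i.1.2.1, i.2.2.2) * wt i)
      + (∑ i, Ψ (i.1.1, i.2.2.1, i.1.2.2) * wt i - ∑ i, Φ (i.1.1, i.2.2.1, i.1.2.2) * wt i)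
      + (∑ i, Ψ (i.2.1, i.1.2.1, i.1.2.2) * wt i - ∑ i, Φ (i.2.1, i.1.2.1, i.1.2.2) * wt i) := by
    simp only [sixSum, ← Finset.sum_sub_distrib, ← Finset.sum_add_distrib]
    refine Finset.sum_le_sum fun i _ => ?_
    change _ * wt i ≤ _ * wt i + _ + _ + _
    rw [← sub_mul, ← sub_mul, ← sub_mul, ← add_mul, ← add_mul, ← add_mul]
    refine mul_le_mul_of_nonneg_right ?_ (hwt i)
    have a := abs_mul_three_sub_le (X := 1) (by norm_num) (hΨ (i.1.1, i.1.2.1, i.2.2.2))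
      (hΨ (i.1.1, i.2.2.1, i.1.2.2)) (hΦ (i.1.1, i.2.2.1, i.1.2.2))
      (hΦ (i.2.1, i.1.2.1, i.1.2.2)) (A₃ := Ψ (i.2.1, i.1.2.1, i.1.2.2))
      (B₁ := Φ (i.1.1, i.1.2.1, i.2.2.2))
    simp only [one_mul] at a
    rw [abs_of_nonneg (sub_nonneg.mpr (hle _)), abs_of_nonneg (sub_nonneg.mpr (hle _)),
      abs_of_nonneg (sub_nonneg.mpr (hle _))] at a
    linarith [le_abs_self (Ψ (i.1.1, i.1.2.1, i.2.2.2) * Ψ (i.1.1, i.2.2.1, i.1.2.2)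
      * Ψ (i.2.1, i.1.2.1, i.1.2.2) - Φ (i.1.1, i.1.2.1, i.2.2.2) * Φ (i.1.1, i.2.2.1, i.1.2.2)
      * Φ (i.2.1, i.1.2.1, i.1.2.2))]
  rw [h1, h1, h2, h2, h3, h3] at key
  linarith

lemma sixSum_mono_smul {Φ : κ × κ × κ → ℝ} (hΦ : ∀ j, Φ j ∈ Icc (0 : ℝ) 1) {s : ℝ}
    (hs : s ∈ Icc (0 : ℝ) 1) {p q r : κ → ℝ} (hp : ∀ i, 0 ≤ p i) (hq : ∀ i, 0 ≤ q i)
    (hr : ∀ i, 0 ≤ r i) : sixSum (fun j => s * Φ j) p q r ≤ sixSum Φ p q r := by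
  refine Finset.sum_le_sum fun i _ => ?_
  have hle : ∀ j, s * Φ j ≤ Φ j := fun j => mul_le_of_le_one_left (hΦ j).1 hs.2
  have h0 : ∀ j, 0 ≤ s * Φ j := fun j => mul_nonneg hs.1 (hΦ j).1
  have := hp i.1.1; have := hq i.1.2.1; have := hr i.1.2.2
  have := hp i.2.1; have := hq i.2.2.1; have := hr i.2.2.2
  refine mul_le_mul_of_nonneg_right ?_ (by positivity)
  refine mul_le_mul (mul_le_mul (hle _) (hle _) (h0 _) (hΦ _).1) (hle _) (h0 _)
    (mul_nonneg (hΦ _).1 (hΦ _).1)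

/-- Jensen's inequality for a convex minorant `g` of `m`, applied to a family of step functions
with common values `Φ` whose means have average at least `α - ε`. The values are first scaled
down, or moved towards `1`, so that the average of the means is exactly `α`. -/
lemma convex_minorant_le_sum_sixSum {α ε : ℝ} (hα : α ∈ Icc (0 : ℝ) 1) (hε : 0 ≤ ε) {g : ℝ → ℝ}
    (hg : ConvexOn ℝ (Icc 0 1) g) (hgm : ∀ β ∈ Icc (0 : ℝ) 1, g β ≤ m β)
    {I : Type} [Fintype I] [Nonempty I] (Φ : κ × κ × κ → ℝ) (hΦ : ∀ j, Φ j ∈ Icc (0 : ℝ) 1)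
    {p q r : I → κ → ℝ} (hp : ∀ u i, 0 ≤ p u i) (hq : ∀ u i, 0 ≤ q u i)
    (hr : ∀ u i, 0 ≤ r u i) (hp1 : ∀ u, ∑ i, p u i = 1) (hq1 : ∀ u, ∑ i, q u i = 1)
    (hr1 : ∀ u, ∑ i, r u i = 1)
    (hmean : (α - ε) * Fintype.card I ≤ ∑ u, meanSum Φ (p u) (q u) (r u)) :
    (g α - 3 * ε) * Fintype.card I ≤ ∑ u, sixSum Φ (p u) (q u) (r u) := by
  have hI : (0 : ℝ) < Fintype.card I := by exact_mod_cast Fintype.card_pos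
  have jensen : ∀ Ψ : κ × κ × κ → ℝ, (∀ j, Ψ j ∈ Icc (0 : ℝ) 1) →
      ∑ u, meanSum Ψ (p u) (q u) (r u) = α * Fintype.card I →
      g α * Fintype.card I ≤ ∑ u, sixSum Ψ (p u) (q u) (r u) := by
    intro Ψ hΨ hmeanΨ
    have h1 := hg.map_sum_le (t := Finset.univ) (w := fun _ : I => (1 : ℝ) / Fintype.card I)
      (p := fun u => meanSum Ψ (p u) (q u) (r u)) (fun _ _ => by positivity)
      (by simp) (fun u _ => meanSum_mem Ψ hΨ (hp u) (hq u) (hr u) (hp1 u) (hq1 u) (hr1 u))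
    simp only [smul_eq_mul, ← Finset.mul_sum] at h1
    rw [hmeanΨ] at h1
    have h2 : 1 / (Fintype.card I : ℝ) * (α * Fintype.card I) = α := by field_simp
    rw [h2, one_div, inv_mul_eq_div, le_div_iff₀ hI] at h1
    refine h1.trans (Finset.sum_le_sum fun u _ => (hgm _ (meanSum_mem Ψ hΨ (hp u) (hq u) (hr u)
      (hp1 u) (hq1 u) (hr1 u))).trans (m_meanSum_le Ψ hΨ (hp u) (hq u) (hr u) (hp1 u) (hq1 u)
      (hr1 u)))
  set S := ∑ u, meanSum Φ (p u) (q u) (r u) with hS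
  have hS1 : S ≤ Fintype.card I := by
    rw [hS]
    refine (Finset.sum_le_sum fun u _ => (meanSum_mem Φ hΦ (hp u) (hq u) (hr u) (hp1 u) (hq1 u)
      (hr1 u)).2).trans_eq (by simp)
  have hS0 : 0 ≤ S := Finset.sum_nonneg fun u _ =>
    (meanSum_mem Φ hΦ (hp u) (hq u) (hr u) (hp1 u) (hq1 u) (hr1 u)).1
  by_cases hcase : α * Fintype.card I ≤ S
  · obtain ⟨s, hs, hsS⟩ : ∃ s ∈ Icc (0 : ℝ) 1, s * S = α * Fintype.card I := by
      rcases hS0.eq_or_lt with h | h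
      · exact ⟨0, by norm_num, by
          rw [zero_mul]; exact le_antisymm (mul_nonneg hα.1 hI.le) (h ▸ hcase)⟩
      · exact ⟨α * Fintype.card I / S, ⟨div_nonneg (mul_nonneg hα.1 hI.le) h.le,
          div_le_one_of_le₀ hcase h.le⟩, div_mul_cancel₀ _ h.ne'⟩
    have h1 := jensen (fun j => s * Φ j) (fun j => mul_mem_unit hs (hΦ j)) (by
      rw [← hsS, hS, Finset.mul_sum]
      refine Finset.sum_congr rfl fun u _ => ?_
      simp only [meanSum, Finset.mul_sum]
      refine Finset.sum_congr rfl fun j _ => ?_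
      ring)
    have h2 := h1.trans (Finset.sum_le_sum fun u _ => sixSum_mono_smul hΦ hs (hp u) (hq u) (hr u))
    nlinarith
  · have hlt : S < α * Fintype.card I := not_le.mp hcase
    have hpos : 0 < Fintype.card I - S := by nlinarith [hα.2]
    set s := (α * Fintype.card I - S) / (Fintype.card I - S) with hs
    have hs0 : 0 ≤ s := div_nonneg (by linarith) hpos.le
    have hs1 : s ≤ 1 := div_le_one_of_le₀ (by nlinarith [hα.2]) hpos.le
    let Ψ : κ × κ × κ → ℝ := fun j => Φ j + s * (1 - Φ j)
    have hΨle : ∀ j, Φ j ≤ Ψ j := fun j =>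
      le_add_of_nonneg_right (mul_nonneg hs0 (by linarith [(hΦ j).2]))
    have hΨ : ∀ j, Ψ j ∈ Icc (0 : ℝ) 1 := fun j => by
      refine ⟨(hΦ j).1.trans (hΨle j), ?_⟩
      have := mul_le_mul_of_nonneg_right hs1 (by linarith [(hΦ j).2] : 0 ≤ 1 - Φ j)
      simp only [Ψ]; linarith
    have hmeanΨ : ∀ u, meanSum Ψ (p u) (q u) (r u)
        = meanSum Φ (p u) (q u) (r u) + s * (1 - meanSum Φ (p u) (q u) (r u)) := by
      intro u
      have hw := sum_weights (hp1 u) (hq1 u) (hr1 u)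
      have : (1 : ℝ) - meanSum Φ (p u) (q u) (r u) = ∑ j : κ × κ × κ,
          (1 - Φ j) * (p u j.1 * q u j.2.1 * r u j.2.2) := by
        simp only [sub_mul, one_mul, Finset.sum_sub_distrib, hw, meanSum]
      rw [this, Finset.mul_sum]
      simp only [meanSum, ← Finset.sum_add_distrib]
      refine Finset.sum_congr rfl fun j _ => ?_
      simp only [Ψ]; ring
    have hsumΨ : ∑ u, meanSum Ψ (p u) (q u) (r u) = α * Fintype.card I := by
      simp only [hmeanΨ, Finset.sum_add_distrib, ← Finset.mul_sum, Finset.sum_sub_distrib]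
      rw [← hS]
      have : ∑ _u : I, (1 : ℝ) = Fintype.card I := by simp
      rw [this, hs, div_mul_cancel₀ _ hpos.ne']; ring
    have h1 := jensen Ψ hΨ hsumΨ
    have h2 := Finset.sum_le_sum (s := Finset.univ) fun u _ =>
      sixSum_le_add hΦ hΨ hΨle (hp u) (hq u) (hr u) (hp1 u) (hq1 u) (hr1 u)
    rw [Finset.sum_add_distrib, ← Finset.mul_sum, Finset.sum_sub_distrib, hsumΨ, ← hS] at h2
    linarith

end Step

/-! ### From cyclic groups to the integers -/

/-- The sum over triples of lines, sorted by the difference `r = c - a - b`. -/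
lemma lineSum_cornerProd_eq {G : Type} [AddCommGroup G] [Fintype G] (ν : G → ℝ)
    (f : G × G → ℝ) :
    lineSum ν (cornerProd f)
      = ∑ r, ν r * ∑ a, ∑ b, f (a, b) * f (a, b + r) * f (a + r, b) := by
  have h1 : lineSum ν (cornerProd f)
      = ∑ a, ∑ b, ∑ r, ν r * (f (a, b) * f (a, b + r) * f (a + r, b)) := by
    refine Finset.sum_congr rfl fun a _ => Finset.sum_congr rfl fun b _ => ?_
    rw [← Equiv.sum_comp (Equiv.addLeft (a + b))]
    refine Finset.sum_congr rfl fun r _ => ?_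
    simp only [Equiv.coe_addLeft, cornerProd]
    rw [show a + b + r - a - b = r by abel, show a + b + r - a = b + r by abel,
      show a + b + r - b = a + r by abel]
  rw [h1]
  simp only [Finset.mul_sum]
  refine Eq.trans ?_ Finset.sum_comm
  refine Finset.sum_congr rfl fun a _ => ?_
  exact Finset.sum_comm

/-- A kernel whose Fourier coefficient at the standard character is close to `1` is concentrated
on short differences. -/
lemma IsKernel.sum_mul_valMinAbs_sq_le {n : ℕ} [NeZero n] {ν : ZMod n → ℝ}
    {t : AddChar (ZMod n) ℂ → ℝ} (hν : IsKernel ν t) :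
    ∑ r, ν r * ((r.valMinAbs : ℝ) / n) ^ 2 ≤ (1 - t ZMod.stdAddChar) / 8 := by
  have hn : (0 : ℝ) < n := by exact_mod_cast Nat.pos_of_ne_zero (NeZero.ne n)
  have h1 : 1 - t ZMod.stdAddChar
      = ∑ r : ZMod n, ν r * (1 - Real.cos (2 * Real.pi * (r.valMinAbs / n))) := by
    have h2 := congrArg Complex.re (hν.ft_eq ZMod.stdAddChar)
    rw [ft, Complex.re_sum, Complex.ofReal_re] at h2
    simp only [mul_sub, mul_one, Finset.sum_sub_distrib, hν.sum_eq_one]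
    rw [← h2]
    congr 1
    refine Finset.sum_congr rfl fun r _ => ?_
    rw [Complex.re_ofReal_mul]
    congr 1
    conv_lhs => rw [← ZMod.coe_valMinAbs r, ZMod.stdAddChar_coe]
    rw [show (2 * Real.pi * Complex.I * (r.valMinAbs : ℤ) / n : ℂ)
      = ((2 * Real.pi * (r.valMinAbs / n) : ℝ) : ℂ) * Complex.I by push_cast; ring,
      Complex.exp_ofReal_mul_I_re]
  rw [h1, Finset.sum_div]
  refine Finset.sum_le_sum fun r _ => ?_
  rw [mul_div_assoc]
  refine mul_le_mul_of_nonneg_left ?_ (hν.nonneg r)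
  have hr := ZMod.valMinAbs_mem_Ioc r
  have hr1 : (-n : ℝ) ≤ r.valMinAbs * 2 := by exact_mod_cast hr.1.le
  have hr2 : (r.valMinAbs * 2 : ℝ) ≤ n := by exact_mod_cast hr.2
  have habs : |2 * Real.pi * ((r.valMinAbs : ℝ) / n)| ≤ Real.pi := by
    have h3 : |(r.valMinAbs : ℝ) / n| ≤ 1 / 2 := by
      rw [abs_le]
      constructor
      · rw [le_div_iff₀ hn]; linarith
      · rw [div_le_iff₀ hn]; linarith
    rw [abs_mul, abs_of_pos (by positivity)]
    nlinarith [Real.pi_pos]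
  have h4 := Real.cos_le_one_sub_mul_cos_sq habs
  have h5 : 2 / Real.pi ^ 2 * (2 * Real.pi * ((r.valMinAbs : ℝ) / n)) ^ 2
      = 8 * ((r.valMinAbs : ℝ) / n) ^ 2 := by
    have := Real.pi_ne_zero
    field_simp; ring
  linarith

lemma eq_of_intCast_eq_of_mem_Icc {n : ℕ} {a b : ℤ} (ha : a ∈ Finset.Icc (1 : ℤ) n)
    (hb : b ∈ Finset.Icc (1 : ℤ) n) (h : (a : ZMod n) = b) : a = b := by
  rw [Finset.mem_Icc] at ha hb
  rw [ZMod.intCast_eq_intCast_iff_dvd_sub] at h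
  have h2 : |b - a| < n := by rw [abs_lt]; omega
  have := Int.eq_zero_of_abs_lt_dvd h h2
  omega

/-- The number of integers of an interval which leave it under a translation. -/
lemma card_filter_notMem_Icc_le (n : ℕ) (ρ : ℤ) :
    (((Finset.Icc (1 : ℤ) n).filter fun x => x + ρ ∉ Finset.Icc (1 : ℤ) n).card : ℤ) ≤ |ρ| := by
  rcases le_total 0 ρ with h | h
  · have hsub : ((Finset.Icc (1 : ℤ) n).filter fun x => x + ρ ∉ Finset.Icc (1 : ℤ) n)
        ⊆ Finset.Ioc ((n : ℤ) - ρ) n := by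
      intro x hx
      simp only [Finset.mem_filter, Finset.mem_Icc, Finset.mem_Ioc] at hx ⊢
      omega
    have := Finset.card_le_card hsub
    rw [Int.card_Ioc] at this
    rw [abs_of_nonneg h]; omega
  · have hsub : ((Finset.Icc (1 : ℤ) n).filter fun x => x + ρ ∉ Finset.Icc (1 : ℤ) n)
        ⊆ Finset.Ico 1 (1 - ρ) := by
      intro x hx
      simp only [Finset.mem_filter, Finset.mem_Icc, Finset.mem_Ico] at hx ⊢
      omega
    have := Finset.card_le_card hsub
    rw [Int.card_Ico] at this
    rw [abs_of_nonpos h]; omega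

/-- The set `A` modulo `n`. -/
def modImage (n : ℕ) (A : Finset (ℤ × ℤ)) : Finset (ZMod n × ZMod n) :=
  A.image fun p => ((p.1 : ZMod n), (p.2 : ZMod n))

lemma card_modImage {n : ℕ} {A : Finset (ℤ × ℤ)}
    (hA : A ⊆ Finset.Icc (1 : ℤ) n ×ˢ Finset.Icc (1 : ℤ) n) : (modImage n A).card = A.card := by
  refine Finset.card_image_of_injOn fun p hp q hq h => ?_
  have hp' := Finset.mem_product.mp (hA hp)
  have hq' := Finset.mem_product.mp (hA hq)
  rw [Prod.mk.injEq] at h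
  exact Prod.ext (eq_of_intCast_eq_of_mem_Icc hp'.1 hq'.1 h.1)
    (eq_of_intCast_eq_of_mem_Icc hp'.2 hq'.2 h.2)

/-- Corners modulo `n` of short difference are corners in the integers, except near the
boundary. -/
lemma card_corners_mod_le {n : ℕ} {A : Finset (ℤ × ℤ)}
    (hA : A ⊆ Finset.Icc (1 : ℤ) n ×ˢ Finset.Icc (1 : ℤ) n) (r : ZMod n) :
    (((modImage n A).filter fun p =>
      (p.1, p.2 + r) ∈ modImage n A ∧ (p.1 + r, p.2) ∈ modImage n A).card : ℤ)
      ≤ cornerCount A r.valMinAbs + 2 * |r.valMinAbs| * n := by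
  classical
  set ρ := r.valMinAbs with hρ
  have hρr : (ρ : ZMod n) = r := ZMod.coe_valMinAbs r
  set I := Finset.Icc (1 : ℤ) n with hI
  set bad := I.filter fun x => x + ρ ∉ I with hbad
  let cast2 : ℤ × ℤ → ZMod n × ZMod n := fun p => ((p.1 : ZMod n), (p.2 : ZMod n))
  have hsub : ((modImage n A).filter fun p =>
      (p.1, p.2 + r) ∈ modImage n A ∧ (p.1 + r, p.2) ∈ modImage n A)
      ⊆ ((A.filter fun p => (p.1, p.2 + ρ) ∈ A ∧ (p.1 + ρ, p.2) ∈ A) ∪ (bad ×ˢ I ∪ I ×ˢ bad)).image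
        cast2 := by
    intro z hz
    obtain ⟨h1, h2, h3⟩ := Finset.mem_filter.mp hz
    obtain ⟨p, hp, rfl⟩ := Finset.mem_image.mp h1
    refine Finset.mem_image.mpr ⟨p, ?_, rfl⟩
    have hpI := Finset.mem_product.mp (hA hp)
    by_cases hx : p.1 + ρ ∈ I
    swap
    · exact Finset.mem_union_right _ (Finset.mem_union_left _ (Finset.mem_product.mpr
        ⟨Finset.mem_filter.mpr ⟨hpI.1, hx⟩, hpI.2⟩))
    by_cases hy : p.2 + ρ ∈ I
    swap
    · exact Finset.mem_union_right _ (Finset.mem_union_right _ (Finset.mem_product.mpr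
        ⟨hpI.1, Finset.mem_filter.mpr ⟨hpI.2, hy⟩⟩))
    refine Finset.mem_union_left _ (Finset.mem_filter.mpr ⟨hp, ?_, ?_⟩)
    · obtain ⟨q, hq, hqe⟩ := Finset.mem_image.mp h2
      have hqI := Finset.mem_product.mp (hA hq)
      rw [Prod.mk.injEq] at hqe
      have e1 := eq_of_intCast_eq_of_mem_Icc hqI.1 hpI.1 hqe.1
      have e2 : q.2 = p.2 + ρ := eq_of_intCast_eq_of_mem_Icc hqI.2 hy
        (by rw [hqe.2]; push_cast; rw [hρr])
      rw [← e1, ← e2]; exact hq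
    · obtain ⟨q, hq, hqe⟩ := Finset.mem_image.mp h3
      have hqI := Finset.mem_product.mp (hA hq)
      rw [Prod.mk.injEq] at hqe
      have e1 : q.1 = p.1 + ρ := eq_of_intCast_eq_of_mem_Icc hqI.1 hx
        (by rw [hqe.1]; push_cast; rw [hρr])
      have e2 := eq_of_intCast_eq_of_mem_Icc hqI.2 hpI.2 hqe.2
      rw [← e1, ← e2]; exact hq
  have hcard := ((Finset.card_le_card hsub).trans Finset.card_image_le).trans
    ((Finset.card_union_le _ _).trans (Nat.add_le_add_left (Finset.card_union_le _ _) _))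
  rw [Finset.card_product, Finset.card_product] at hcard
  have hIc : I.card = n := by simp [hI]
  rw [hIc] at hcard
  have hb : (bad.card : ℤ) ≤ |ρ| := card_filter_notMem_Icc_le n ρ
  have hcard' : (((modImage n A).filter fun p =>
      (p.1, p.2 + r) ∈ modImage n A ∧ (p.1 + r, p.2) ∈ modImage n A).card : ℤ)
      ≤ cornerCount A ρ + (bad.card * n + n * bad.card) := by exact_mod_cast hcard
  have := mul_le_mul_of_nonneg_right hb (Int.natCast_nonneg n)
  linarith

/-- The conclusion of the theorem for a single convex minorant `g` of `m`. -/
theorem exists_popular_difference_of_convex (ε : ℝ) (hε : 0 < ε) : ∃ N : ℕ, ∀ n : ℕ, N ≤ n →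
    ∀ α ∈ Icc (0 : ℝ) 1, ∀ g : ℝ → ℝ, ConvexOn ℝ (Icc 0 1) g → (∀ β ∈ Icc (0 : ℝ) 1, g β ≤ m β) →
    ∀ A : Finset (ℤ × ℤ), A ⊆ Finset.Icc (1 : ℤ) (n : ℤ) ×ˢ Finset.Icc (1 : ℤ) (n : ℤ) →
    α * (n : ℝ) ^ 2 ≤ (A.card : ℝ) →
    ∃ r : ℤ, r ≠ 0 ∧ (g α - ε) * (n : ℝ) ^ 2 ≤ (cornerCount A r : ℝ) := by
  classical
  -- the error terms below add up to `4 e + 2 (ε / 16) + M / n`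
  set e := min (ε / 16) ((ε / 16) ^ 2) with he
  have he0 : 0 < e := by positivity
  have he1 : e ≤ ε / 16 := min_le_left _ _
  have he2 : e ≤ (ε / 16) ^ 2 := min_le_right _ _
  obtain ⟨M, hM⟩ := exists_kernel_corner_count e he0
  obtain ⟨N, hN⟩ := exists_nat_gt (2 * M / ε)
  refine ⟨N + 1, fun n hn α hα g hg hgm A hA hAα => ?_⟩
  have hnpos : 0 < n := by omega
  have : NeZero n := ⟨hnpos.ne'⟩
  have hnr : (0 : ℝ) < n := by exact_mod_cast hnpos
  have hMn : M ≤ ε / 2 * n := by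
    have h1 : (N : ℝ) ≤ n := by exact_mod_cast (by omega : N ≤ n)
    rw [div_lt_iff₀ hε] at hN
    nlinarith
  by_contra! hcon
  have hcon' := hcon 1 one_ne_zero
  have hpos : 0 ≤ (g α - ε) * (n : ℝ) ^ 2 := (Nat.cast_nonneg _).trans hcon'.le
  set B := modImage n A with hB
  let f : ZMod n × ZMod n → ℝ := fun ω => if ω ∈ B then 1 else 0
  have hf : ∀ ω, f ω ∈ Icc (0 : ℝ) 1 := fun ω => by
    simp only [f]; split_ifs <;> norm_num
  obtain ⟨ν, t, hν, htM, ht1, κ, _, Φ, p, hΦ, hp, hp1, hcount, hmean⟩ :=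
    hM (ZMod n) ZMod.stdAddChar f hf
  rw [ZMod.card] at hcount hmean
  -- lower bound for the averaged corner count
  have hsumf : ∑ ω, f ω = A.card := by
    simp only [f, Finset.sum_ite_mem, Finset.univ_inter, Finset.sum_const, nsmul_eq_mul, mul_one]
    rw [hB, card_modImage hA]
  have hlow : (g α - 4 * e) * (n : ℝ) ^ 2 ≤ lineSum ν (cornerProd f) := by
    have h1 := convex_minorant_le_sum_sixSum (I := ZMod n × ZMod n) hα he0.le hg hgm Φ hΦ
      (p := fun u i => p i u.1) (q := fun u i => p i u.2) (r := fun u i => p i (u.1 + u.2))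
      (fun u i => hp _ _) (fun u i => hp _ _) (fun u i => hp _ _)
      (fun u => hp1 _) (fun u => hp1 _) (fun u => hp1 _) (by
        rw [Fintype.sum_prod_type, Fintype.card_prod, ZMod.card]
        push_cast
        have := (abs_le.mp hmean).2
        rw [hsumf] at this
        linarith)
    rw [Fintype.sum_prod_type, Fintype.card_prod, ZMod.card] at h1
    push_cast at h1
    have := (abs_le.mp hcount).1
    linarith
  -- upper bound for the averaged corner count
  have hν0 : ν 0 * n ≤ M := by
    have h1 := hν.sum_ft 0
    simp only [AddChar.map_zero_eq_one, mul_one, ZMod.card] at h1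
    have h2 : ∑ γ, t γ = n * ν 0 := by exact_mod_cast h1
    linarith
  have hcorner : ∀ r : ZMod n, ∑ a, ∑ b, f (a, b) * f (a, b + r) * f (a + r, b)
      = ((B.filter fun p => (p.1, p.2 + r) ∈ B ∧ (p.1 + r, p.2) ∈ B).card : ℝ) := by
    intro r
    rw [← Fintype.sum_prod_type' fun a b => f (a, b) * f (a, b + r) * f (a + r, b),
      Finset.card_filter, Nat.cast_sum, ← Finset.sum_subset (Finset.subset_univ B)]
    · refine Finset.sum_congr rfl fun x hx => ?_
      by_cases h1 : (x.1, x.2 + r) ∈ B <;> by_cases h2 : (x.1 + r, x.2) ∈ B <;> simp [f, hx, h1, h2]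
    · intro x _ hx
      simp [f, hx]
  have hterm : ∀ r : ZMod n, ν r * ∑ a, ∑ b, f (a, b) * f (a, b + r) * f (a + r, b)
      ≤ (if r = 0 then ν 0 * (n : ℝ) ^ 2 else 0) + ν r * ((g α - ε) * (n : ℝ) ^ 2)
        + ν r * (2 * |(r.valMinAbs : ℝ)| * n) := by
    intro r
    have h1 : (((B.filter fun p => (p.1, p.2 + r) ∈ B ∧ (p.1 + r, p.2) ∈ B).card : ℕ) : ℝ)
        ≤ cornerCount A r.valMinAbs + 2 * |(r.valMinAbs : ℝ)| * n := by
      exact_mod_cast card_corners_mod_le hA r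
    rw [hcorner]
    by_cases hr : r = 0
    · rw [if_pos hr, hr]
      have h2 : (((B.filter fun p => (p.1, p.2 + (0 : ZMod n)) ∈ B ∧
          (p.1 + (0 : ZMod n), p.2) ∈ B).card : ℕ) : ℝ) ≤ (n : ℝ) ^ 2 := by
        have h3 := Finset.card_le_univ (B.filter fun p => (p.1, p.2 + (0 : ZMod n)) ∈ B ∧
          (p.1 + (0 : ZMod n), p.2) ∈ B)
        rw [Fintype.card_prod, ZMod.card] at h3
        rw [sq]; exact_mod_cast h3
      have h4 := mul_le_mul_of_nonneg_left h2 (hν.nonneg 0)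
      have h5 := mul_nonneg (hν.nonneg 0) hpos
      have h6 : 0 ≤ ν 0 * (2 * |(((0 : ZMod n).valMinAbs : ℤ) : ℝ)| * n) :=
        mul_nonneg (hν.nonneg 0) (by positivity)
      linarith
    · rw [if_neg hr]
      have h2 := hcon r.valMinAbs (by rwa [Ne, ZMod.valMinAbs_eq_zero])
      have := mul_le_mul_of_nonneg_left (h1.trans (add_le_add_left h2.le _)) (hν.nonneg r)
      linarith
  have hshort : ∑ r, ν r * (2 * |(r.valMinAbs : ℝ)| * n) ≤ ε / 8 * (n : ℝ) ^ 2 := by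
    have h1 := hν.sum_mul_valMinAbs_sq_le
    have h2 : ∀ r : ZMod n, ν r * (2 * |(r.valMinAbs : ℝ)| * n)
        ≤ ν r * (ε / 16 * (n : ℝ) ^ 2)
          + 16 / ε * (n : ℝ) ^ 2 * (ν r * ((r.valMinAbs : ℝ) / n) ^ 2) := by
      intro r
      set x := |(r.valMinAbs : ℝ)| / n with hx
      have hx1 : |(r.valMinAbs : ℝ)| = x * n := by rw [hx]; field_simp
      have hx2 : ((r.valMinAbs : ℝ) / n) ^ 2 = x ^ 2 := by rw [hx, div_pow, div_pow, sq_abs]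
      rw [hx1, hx2]
      -- the inequality of arithmetic and geometric means
      have h3 : 2 * x ≤ ε / 16 + 16 / ε * x ^ 2 := by
        have : 0 ≤ 16 / ε * (x - ε / 16) ^ 2 := by positivity
        have h4 : 16 / ε * (x - ε / 16) ^ 2 = 16 / ε * x ^ 2 - 2 * x + ε / 16 := by
          field_simp; ring
        linarith
      have := mul_le_mul_of_nonneg_left h3 (mul_nonneg (hν.nonneg r) (sq_nonneg (n : ℝ)))
      linarith
    refine (Finset.sum_le_sum fun r _ => h2 r).trans ?_
    rw [Finset.sum_add_distrib, ← Finset.sum_mul, ← Finset.mul_sum, hν.sum_eq_one, one_mul]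
    have h3 : ∑ r, ν r * ((r.valMinAbs : ℝ) / n) ^ 2 ≤ (ε / 16) ^ 2 := by
      have : 0 < (ε / 16) ^ 2 := by positivity
      linarith
    have h4 := mul_le_mul_of_nonneg_left h3 (by positivity : 0 ≤ 16 / ε * (n : ℝ) ^ 2)
    have h5 : 16 / ε * (n : ℝ) ^ 2 * (ε / 16) ^ 2 = ε / 16 * (n : ℝ) ^ 2 := by
      field_simp
    linarith
  have hup : lineSum ν (cornerProd f) ≤ M * n + (g α - ε) * (n : ℝ) ^ 2 + ε / 8 * (n : ℝ) ^ 2 := by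
    rw [lineSum_cornerProd_eq]
    refine (Finset.sum_le_sum fun r _ => hterm r).trans ?_
    rw [Finset.sum_add_distrib, Finset.sum_add_distrib, Finset.sum_ite_eq' Finset.univ,
      if_pos (Finset.mem_univ _), ← Finset.sum_mul, hν.sum_eq_one, one_mul]
    have := mul_le_mul_of_nonneg_right hν0 hnr.le
    linarith
  have h1 := mul_le_mul_of_nonneg_right hMn hnr.le
  have h2 := mul_le_mul_of_nonneg_right he1 (sq_nonneg (n : ℝ))
  have h3 : 0 < ε * (n : ℝ) ^ 2 := by positivity
  linarith

end PopularCorners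

theorem mainTheorem3 (α : ℝ) (hα : α ∈ Set.Icc (0 : ℝ) 1) :
    ∀ ε : ℝ, 0 < ε → ∃ N : ℕ, ∀ n : ℕ, N ≤ n →
      ∀ A : Finset (ℤ × ℤ),
        A ⊆ Finset.Icc (1 : ℤ) (n : ℤ) ×ˢ Finset.Icc (1 : ℤ) (n : ℤ) →
        α * (n : ℝ) ^ 2 ≤ (A.card : ℝ) →
        ∃ r : ℤ, r ≠ 0 ∧
          (PopularCorners.m' α - ε) * (n : ℝ) ^ 2 ≤ (PopularCorners.cornerCount A r : ℝ) := by
  intro ε hε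
  obtain ⟨N, hN⟩ := PopularCorners.exists_popular_difference_of_convex (ε / 2) (half_pos hε)
  refine ⟨N, fun n hn A hA hAα => ?_⟩
  -- a convex minorant of `m` that nearly attains the supremum defining `m'` at `α`
  obtain ⟨_, ⟨g, hg, hgm, rfl⟩, hlt⟩ := exists_lt_of_lt_csSup
    (s := {t : ℝ | ∃ g : ℝ → ℝ, ConvexOn ℝ (Icc 0 1) g ∧
      (∀ β ∈ Icc (0 : ℝ) 1, g β ≤ PopularCorners.m β) ∧ t = g α})
    (b := PopularCorners.m' α - ε / 2)
    ⟨0, fun _ => 0, convexOn_const 0 (convex_Icc 0 1), fun β _ => PopularCorners.m_nonneg β, rfl⟩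
    (by change _ < PopularCorners.m' α; linarith)
  obtain ⟨r, hr, h⟩ := hN n hn α hα g hg hgm A hA hAα
  refine ⟨r, hr, le_trans (mul_le_mul_of_nonneg_right ?_ (sq_nonneg _)) h⟩
  linarith
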